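/- **Conventions.** For a category $\mathbb B$ and a list $\alpha\in\mathrm{List}\{+,-\}$ of length $|\alpha|$ (also regarded as the set $\{1,\dots,|\alpha|\}$), let $\mathbb B^\alpha=\mathbb B^{\alpha_1}\times\dots\times\mathbb B^{\alpha_{|\alpha|}}$ with $\mathbb B^+=\mathbb B$, $\mathbb B^-=\mathbb B^{op}$ (the terminal category if $\alpha$ is empty). For $n\ge 0$, write $n$ also for $\{1,\dots,n\}$. For functors $F:\mathbb B^\alpha\to\mathbb C$, $G:\mathbb B^\beta\to\mathbb C$, a *transformation* $\phi:F\to G$ of type $|\alpha|\xrightarrow{\sigma}n\xleftarrow{\tau}|\beta|$ is a family of morphisms $\phi_{\mathbf A}:F(\mathbf A\sigma)\to G(\mathbf A\tau)$, $\mathbf A\in\mathrm{Ob}(\mathbb B)^n$. Let $\mathbf A[X,Y/i]\sigma$ be the tuple with $j$-th entry $X$ if $\sigma j=i,\alpha_j=-$; $Y$ if $\sigma j=i,\alpha_j=+$; and $A_{\sigma j}$ otherwise (similarly for morphisms). Then $\phi$ is *dinatural in its $i$-th variable* if for all $\mathbf A$ and all $f:X\to Y$ in $\mathbb B$ $$G(\mathbf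 A[X,f/i]\tau)\circ\phi_{\mathbf A[X/i]}\circ F(\mathbf A[f,X/i]\sigma)=G(\mathbf A[f,Y/i]\tau)\circ\phi_{\mathbf A[Y/i]}\circ F(\mathbf A[Y,f/i]\sigma).$$ A *Petri net* $N$ consists of finite sets $P$ of places and $T$ of transitions and functions ${}^\bullet(-),(-)^\bullet:T\to\mathcal P(P)$ (inputs, outputs), with no place both an input and an output of the same transition; it is viewed as a directed bipartite graph with arcs $p\to t$ for $p\in{}^\bullet t$ and $t\to p$ for $p\in t^\bullet$. Connected components are taken with respect to undirected paths; a component is acyclic if it contains no directed cycle of positive length. $N$ is *FBCF* if every place is an input of at most one transition and an output of at most one transition. A place is a *source* (*sink*) if it is an output (input) of no transition. The *standard graph* $\Gamma(\phi)$ of $\phi$ has places $|\alpha|+|\beta|$ and transitions $n$; the inputs of $t$ are the $p\in|\alpha|$ with $\sigma p=t,\alpha_p=+$ and the $p\in|\beta|$ with $\tau p=t,\beta_p=-$; its outputs are the $p\in|\alpha|$ with $\sigma p=t,\alpha_p=-$ and the $p\in|\beta|$ with $\tau p=t,\beta_p=+$. **The data of $\{\mathbb B,\mathbb C\}$.** Objects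 are pairs $(\alpha,F:\mathbb B^\alpha\to\mathbb C)$. Morphisms $(\alpha,F)\to(\beta,G)$ are equivalence classes of tuples $$\Phi=(\phi,\ |\alpha|\xrightarrow{\sigma}n\xleftarrow{\tau}|\beta|,\ |\alpha|\xrightarrow{\bar\sigma}N\xleftarrow{\bar\tau}|\beta|,\ \Delta_\Phi)$$ in which * $\phi:F\to G$ is a transformation of type $(\sigma,\tau)$; * $N$ is an FBCF Petri net whose connected components are numbered bijectively by $1,\dots,n$; $\bar\sigma:|\alpha|\to P_N$ and $\bar\tau:|\beta|\to P_N$ are injective; the set of sources of $N$ is $\{\bar\sigma(i)\mid\alpha_i=+\}\cup\{\bar\tau(i)\mid\beta_i=-\}$ and the set of sinks is $\{\bar\sigma(i)\mid\alpha_i=-\}\cup\{\bar\tau(i)\mid\beta_i=+\}$; $\bar\sigma(i)$ lies in the $\sigma(i)$-th and $\bar\tau(j)$ in the $\tau(j)$-th component; * $\Delta_\Phi:n\to\{0,1\}$ is such that $\Delta_\Phi(i)=1$ implies that the $i$-th component of $N$ is acyclic and $\phi$ is dinatural in its $i$-th variable; * if $N$ has no transitions, then $(\alpha,F)=(\beta,G)$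 and $\Phi$ is equivalent to the *identity tuple* $(\mathrm{id}_F,\ |\alpha|=|\alpha|=|\alpha|,\ |\alpha|=|\alpha|=|\alpha|,\ 1)$, whose net has places $|\alpha|$ and no transitions and whose discriminant is constantly $1$; * $\Phi$ is equivalent to an identity tuple, or it is *atomic*, i.e. equivalent to a tuple with $N=\Gamma(\phi)$ and $\bar\sigma,\bar\tau$ the two injections, or it is equivalent to a composite (as defined below) of finitely many atomic tuples, each satisfying the preceding conditions. Two tuples $\Phi,\Phi'$ are *equivalent* if there are a permutation $\pi$ of $n$ and an isomorphism of nets $f:N\to N'$ with $\sigma'=\pi\sigma$, $\tau'=\pi\tau$, $\phi'_{\mathbf A}=\phi_{\mathbf A\pi}$, $\Delta_\Phi=\Delta_{\Phi'}\pi$, $f\bar\sigma=\bar\sigma'$, $f\bar\tau=\bar\tau'$, and $f$ mapping the $i$-th component of $N$ onto the $\pi(i)$-th component of $N'$. The *composite* of $\Phi$ with $\Psi=(\psi,|\beta|\xrightarrow{\eta}m\xleftarrow{\theta}|\gamma|,|\beta|\xrightarrow{\bar\eta}N'\xleftarrow{\bar\theta}|\gamma|,\Delta_\Psi):(\beta,G)\to(\gamma,H)$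 is the class of the following tuple $\Psi\circ\Phi$. Let $n\xrightarrow{\zeta}l\xleftarrow{\xi}m$ be a pushout of $n\xleftarrow{\tau}|\beta|\xrightarrow{\eta}m$ in finite sets. The transformation has type $(\zeta\sigma,\xi\theta)$ and components $(\psi\circ\phi)_{\mathbf A}=\psi_{\mathbf A\xi}\circ\phi_{\mathbf A\zeta}$. The net $N'\circ N$ is obtained by gluing $N$ and $N'$ along $|\beta|$: its places are the pushout of $P_N\xleftarrow{\bar\tau}|\beta|\xrightarrow{\bar\eta}P_{N'}$, its transitions are $T_N+T_{N'}$, with inputs and outputs inherited; $|\alpha|$ and $|\gamma|$ map to it through $\bar\sigma$ and $\bar\theta$; vertices in the $y$-th component of $N$ (the $z$-th of $N'$) are in the component numbered $\zeta(y)$ (resp. $\xi(z)$). Finally $\Delta_{\Psi\circ\Phi}(x)=1$ if and only if the $x$-th component of $N'\circ N$ is acyclic and $\Delta_\Phi(y)=1=\Delta_\Psi(z)$ for all $y\in\zeta^{-1}\{x\}$, $z\in\xi^{-1}\{x\}$. **Theorem.** For all categories $\mathbb B$, $\mathbb C$, $\{\mathbb B,\mathbb C\}$ is a category: every identity tuple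 represents a morphism; if $\Phi$ and $\Psi$ represent composable morphisms then so does $\Psi\circ\Phi$ (in particular $\psi\circ\phi$ is dinatural in every variable $x$ with $\Delta_{\Psi\circ\Phi}(x)=1$); the class of $\Psi\circ\Phi$ depends only on the classes of $\Phi$ and $\Psi$; and composition of classes is associative and has the classes of the identity tuples as units. -/

import Mathlib

open CategoryTheory

attribute [-instance] CategoryTheory.catToReflQuiver

universe v₁ v₂ u₁ u₂

namespace GenFun

/-! ### Functors of mixed variance -/

/-- The two signs `+` and `-`. -/
inductive Variance : Type
  | plus
  | minus

/-- `B⁺ = B` and `B⁻ = Bᵒᵖ`. -/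
def Signed (B : Type u₁) : Variance → Type u₁
  | .plus => B
  | .minus => Bᵒᵖ

instance (B : Type u₁) [Category.{v₁} B] : ∀ s : Variance, Category.{v₁} (Signed B s)
  | .plus => inferInstanceAs (Category.{v₁} B)
  | .minus => inferInstanceAs (Category.{v₁} Bᵒᵖ)

/-- The product category `B^α = B^{α₁} × ⋯ × B^{αₙ}` (the terminal category if `α` is empty). -/
abbrev MixedPow (B : Type u₁) (α : List Variance) : Type u₁ :=
  ∀ j : Fin α.length, Signed B (α.get j)

/-- The object of `B^s` which is `X` if `s` is contravariant and `Y` if `s` is covariant. -/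
def Signed.mix {B : Type u₁} : ∀ (s : Variance) (_ _ : B), Signed B s
  | .plus, _, Y => (Y : B)
  | .minus, X, _ => (Opposite.op X : Bᵒᵖ)

/-- `Signed.mix` on morphisms: contravariant in the first object, covariant in the second. -/
def Signed.mixMap {B : Type u₁} [Category.{v₁} B] {X X' Y Y' : B} :
    ∀ (s : Variance) (_ : X' ⟶ X) (_ : Y ⟶ Y'), (Signed.mix s X Y ⟶ Signed.mix s X' Y')
  | .plus, _, h => (h : (Y : B) ⟶ Y')
  | .minus, g, _ => (g.op : (Opposite.op X : Bᵒᵖ) ⟶ Opposite.op X')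

/-- The tuple whose `j`-th entry is `A (σ j)` if `αⱼ = -` and `A' (σ j)` if `αⱼ = +`.
In particular `args A A σ` is the tuple `A σ`. -/
def args {B : Type u₁} {α : List Variance} {V : Type} (A A' : V → B)
    (σ : Fin α.length → V) : MixedPow B α :=
  fun j => Signed.mix (α.get j) (A (σ j)) (A' (σ j))

/-- `args` on families of morphisms. -/
def argsMap {B : Type u₁} [Category.{v₁} B] {α : List Variance} {V : Type}
    {A₁ A₁' A₂ A₂' : V → B} (g : ∀ v, A₁' v ⟶ A₁ v) (h : ∀ v, A₂ v ⟶ A₂' v)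
    (σ : Fin α.length → V) : (args A₁ A₂ σ : MixedPow B α) ⟶ args A₁' A₂' σ :=
  fun j => Signed.mixMap (α.get j) (g (σ j)) (h (σ j))

/-! ### Transformations and dinaturality -/

/-- A transformation `F → G` of type `|α| → V ← |β|`, with `V` the set of variables. -/
structure Transformation {B : Type u₁} [Category.{v₁} B] {C : Type u₂} [Category.{v₂} C]
    {α β : List Variance} (V : Type) (F : MixedPow B α ⥤ C) (G : MixedPow B β ⥤ C) where
  σ : Fin α.length → V
  τ : Fin β.length → V
  app : ∀ A : V → B, F.obj (args A A σ) ⟶ G.obj (args A A τ)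

open Classical in
/-- `A[X/i]`. -/
noncomputable def subst {B : Type u₁} {V : Type} (A : V → B) (i : V) (X : B) : V → B :=
  fun v => if v = i then X else A v

open Classical in
/-- The family `A[f/i] : A[X/i] → A[Y/i]` which is `f` at `i` and the identity elsewhere. -/
noncomputable def substHom {B : Type u₁} [Category.{v₁} B] {V : Type} (A : V → B) (i : V)
    {X Y : B} (f : X ⟶ Y) (v : V) : subst A i X v ⟶ subst A i Y v :=
  if h : v = i then eqToHom (if_pos h) ≫ f ≫ eqToHom (if_pos h).symm
  else eqToHom ((if_neg h).trans (if_neg h).symm)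

/-- Dinaturality of a transformation in its `i`-th variable: commutativity of the hexagon from
`F(A[Y,X/i]σ)` to `G(A[X,Y/i]τ)` for every `f : X ⟶ Y`. -/
def Transformation.DinaturalAt {B : Type u₁} [Category.{v₁} B] {C : Type u₂} [Category.{v₂} C]
    {α β : List Variance} {V : Type} {F : MixedPow B α ⥤ C} {G : MixedPow B β ⥤ C}
    (φ : Transformation V F G) (i : V) : Prop :=
  ∀ (A : V → B) {X Y : B} (f : X ⟶ Y),
    F.map (argsMap (substHom A i f) (fun v => 𝟙 (subst A i X v)) φ.σ) ≫
        φ.app (subst A i X) ≫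
        G.map (argsMap (fun v => 𝟙 (subst A i X v)) (substHom A i f) φ.τ) =
      F.map (argsMap (fun v => 𝟙 (subst A i Y v)) (substHom A i f) φ.σ) ≫
        φ.app (subst A i Y) ≫
        G.map (argsMap (substHom A i f) (fun v => 𝟙 (subst A i Y v)) φ.τ)

/-! ### Pushouts of sets -/

/-- The pushout of `f : S → X` and `g : S → Y` in sets. -/
def Pushout {S X Y : Type} (f : S → X) (g : S → Y) : Type :=
  Quot (fun a b : X ⊕ Y => ∃ s, a = Sum.inl (f s) ∧ b = Sum.inr (g s))

namespace Pushout

variable {S X Y Z : Type} {f : S → X} {g : S → Y}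

def inl (x : X) : Pushout f g := Quot.mk _ (Sum.inl x)

def inr (y : Y) : Pushout f g := Quot.mk _ (Sum.inr y)

theorem condition (s : S) : (inl (f s) : Pushout f g) = inr (g s) :=
  Quot.sound ⟨s, rfl, rfl⟩

def desc (h : X → Z) (k : Y → Z) (w : ∀ s, h (f s) = k (g s)) : Pushout f g → Z :=
  Quot.lift (Sum.elim h k) (by rintro _ _ ⟨s, rfl, rfl⟩; exact w s)

theorem desc_unique (h : X → Z) (k : Y → Z) (w : ∀ s, h (f s) = k (g s))
    (d : Pushout f g → Z) (hl : ∀ x, d (inl x) = h x) (hr : ∀ y, d (inr y) = k y) :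
    d = desc h k w := by
  funext q
  induction q using Quot.ind with
  | mk a => cases a with
    | inl x => exact hl x
    | inr y => exact hr y

instance [Finite X] [Finite Y] : Finite (Pushout f g) :=
  inferInstanceAs (Finite (Quot _))

end Pushout

/-! ### Petri nets -/

/-- A Petri net, with its places, transitions, and the sets of inputs and outputs of every
transition. -/
structure PetriNet where
  P : Type
  T : Type
  [finite_P : Finite P]
  [finite_T : Finite T]
  inp : T → Set P
  out : T → Set P

namespace PetriNet

variable (N : PetriNet)

/-- Vertices are places and transitions. -/
abbrev Vertex : Type := N.P ⊕ N.T

/-- There is an arc from a place to a transition of which it is an input, and from a transition to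
each of its outputs. -/
inductive Arc : N.Vertex → N.Vertex → Prop
  | inp {p : N.P} {t : N.T} : p ∈ N.inp t → Arc (Sum.inl p) (Sum.inr t)
  | out {p : N.P} {t : N.T} : p ∈ N.out t → Arc (Sum.inr t) (Sum.inl p)

/-- Being in the same connected component, i.e. joined by a (possibly trivial) undirected path. -/
def Connected : N.Vertex → N.Vertex → Prop := Relation.EqvGen N.Arc

/-- The vertex `x` lies on a cycle. -/
def OnCycle (x : N.Vertex) : Prop := Relation.TransGen N.Arc x x

def NoSelfLoop : Prop := ∀ t p, ¬ (p ∈ N.inp t ∧ p ∈ N.out t)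

/-- Forward-backward conflict free: every place has at most one input transition and at most one
output transition. -/
def FBCF : Prop :=
  (∀ p t t', p ∈ N.inp t → p ∈ N.inp t' → t = t') ∧
    ∀ p t t', p ∈ N.out t → p ∈ N.out t' → t = t'

def sources : Set N.P := {p | ∀ t, p ∉ N.out t}

def sinks : Set N.P := {p | ∀ t, p ∉ N.inp t}

/-- Gluing two nets along an interface `S` of places (places and transitions are pushouts). -/
def glue (N N' : PetriNet) {S : Type} (ρ : S → N.P) (l : S → N'.P) : PetriNet where
  P := Pushout ρ l
  T := N.T ⊕ N'.T
  finite_P := by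
    have := N.finite_P
    have := N'.finite_P
    infer_instance
  finite_T := by
    have := N.finite_T
    have := N'.finite_T
    infer_instance
  inp := Sum.elim (fun t => Pushout.inl '' N.inp t) (fun t => Pushout.inr '' N'.inp t)
  out := Sum.elim (fun t => Pushout.inl '' N.out t) (fun t => Pushout.inr '' N'.out t)

end PetriNet

/-- A cospan `|α| → N ← |β|` whose middle is a Petri net `N`, together with an assignment of an
index in `V` to each vertex of `N` (intended: the connected component to which it belongs). -/
structure NetCospan (α β : List Variance) (V : Type) where
  net : PetriNet
  left : Fin α.length → net.P
  right : Fin β.length → net.P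
  index : net.Vertex → V

/-- The cospan represents a graph from `α` to `β` and `index` numbers the connected components of
the net by the elements of `V`. -/
structure NetCospan.IsGraph {α β : List Variance} {V : Type} (u : NetCospan α β V) : Prop where
  fbcf : u.net.FBCF
  noSelfLoop : u.net.NoSelfLoop
  left_injective : Function.Injective u.left
  right_injective : Function.Injective u.right
  sources_eq : u.net.sources =
    {p | (∃ j, α.get j = .plus ∧ u.left j = p) ∨ ∃ j, β.get j = .minus ∧ u.right j = p}
  sinks_eq : u.net.sinks =
    {p | (∃ j, α.get j = .minus ∧ u.left j = p) ∨ ∃ j, β.get j = .plus ∧ u.right j = p}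
  index_eq_iff : ∀ x y, u.index x = u.index y ↔ u.net.Connected x y
  index_surjective : Function.Surjective u.index

/-- The `i`-th connected component of the net is acyclic. -/
def NetCospan.AcyclicAt {α β : List Variance} {V : Type} (u : NetCospan α β V) (i : V) : Prop :=
  ∀ x, u.index x = i → ¬ u.net.OnCycle x

/-! ### Objects and morphisms of the generalised functor category -/

/-- Objects of `{B, C}`: pairs `(α, F : B^α ⥤ C)`. -/
structure Obj (B : Type u₁) [Category.{v₁} B] (C : Type u₂) [Category.{v₂} C] where
  arity : List Variance
  functor : MixedPow B arity ⥤ C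

section

variable {B : Type u₁} [Category.{v₁} B] {C : Type u₂} [Category.{v₂} C]

/-- Tuples `(φ, |α| → V ← |β|, |α| → N ← |β|, Δ)`, with the two ends of the graph in the connected
components prescribed by the type of `φ`. The remaining requirements are in `Tuple.IsValid`. -/
structure Tuple (X Y : Obj B C) where
  V : Type
  [finite_V : Finite V]
  trans : Transformation V X.functor Y.functor
  graph : NetCospan X.arity Y.arity V
  index_left : ∀ j, graph.index (Sum.inl (graph.left j)) = trans.σ j
  index_right : ∀ j, graph.index (Sum.inl (graph.right j)) = trans.τ j
  disc : V → Bool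

namespace Tuple

variable {X Y Z : Obj B C}

/-- The graph is a legitimate one, and a variable of discriminant `1` has an acyclic connected
component and is one in which the transformation is dinatural. -/
structure IsValid (Φ : Tuple X Y) : Prop where
  isGraph : Φ.graph.IsGraph
  disc_spec : ∀ i, Φ.disc i = true → Φ.graph.AcyclicAt i ∧ Φ.trans.DinaturalAt i

/-- An equivalence between two tuples: a bijection of the variables and an isomorphism of the nets
that are compatible with all the data. -/
structure Equivalence (Φ Φ' : Tuple X Y) where
  π : Φ.V ≃ Φ'.V
  fP : Φ.graph.net.P ≃ Φ'.graph.net.P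
  fT : Φ.graph.net.T ≃ Φ'.graph.net.T
  σ_eq : Φ'.trans.σ = π ∘ Φ.trans.σ
  τ_eq : Φ'.trans.τ = π ∘ Φ.trans.τ
  app_eq : ∀ A : Φ'.V → B, HEq (Φ'.trans.app A) (Φ.trans.app (A ∘ π))
  disc_eq : ∀ i, Φ.disc i = Φ'.disc (π i)
  inp_eq : ∀ t, Φ'.graph.net.inp (fT t) = fP '' Φ.graph.net.inp t
  out_eq : ∀ t, Φ'.graph.net.out (fT t) = fP '' Φ.graph.net.out t
  left_eq : ∀ j, fP (Φ.graph.left j) = Φ'.graph.left j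
  right_eq : ∀ j, fP (Φ.graph.right j) = Φ'.graph.right j
  index_eq : ∀ x, Φ'.graph.index (Sum.map fP fT x) = π (Φ.graph.index x)

def Equivalence.refl (Φ : Tuple X Y) : Equivalence Φ Φ where
  π := Equiv.refl _
  fP := Equiv.refl _
  fT := Equiv.refl _
  σ_eq := rfl
  τ_eq := rfl
  app_eq _ := HEq.rfl
  disc_eq _ := rfl
  inp_eq t := by simp
  out_eq t := by simp
  left_eq _ := rfl
  right_eq _ := rfl
  index_eq x := by cases x <;> rfl

def Equivalence.symm {Φ Φ' : Tuple X Y} (e : Equivalence Φ Φ') : Equivalence Φ' Φ where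
  π := e.π.symm
  fP := e.fP.symm
  fT := e.fT.symm
  σ_eq := by rw [e.σ_eq]; funext j; simp
  τ_eq := by rw [e.τ_eq]; funext j; simp
  app_eq A := by
    have h : (A ∘ e.π.symm) ∘ e.π = A := by funext v; simp
    have := e.app_eq (A ∘ e.π.symm)
    rw [h] at this
    exact this.symm
  disc_eq i := by rw [e.disc_eq]; simp
  inp_eq t := by
    have := e.inp_eq (e.fT.symm t)
    rw [Equiv.apply_symm_apply] at this
    rw [this, ← Set.image_comp]; simp
  out_eq t := by
    have := e.out_eq (e.fT.symm t)
    rw [Equiv.apply_symm_apply] at this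
    rw [this, ← Set.image_comp]; simp
  left_eq j := by rw [← e.left_eq]; simp
  right_eq j := by rw [← e.right_eq]; simp
  index_eq x := by
    have := e.index_eq (Sum.map e.fP.symm e.fT.symm x)
    rw [Sum.map_map] at this
    simp only [Equiv.self_comp_symm, Sum.map_id_id, id_eq] at this
    rw [this]; simp

def Equivalence.trans {Φ Φ' Φ'' : Tuple X Y} (e : Equivalence Φ Φ') (e' : Equivalence Φ' Φ'') :
    Equivalence Φ Φ'' where
  π := e.π.trans e'.π
  fP := e.fP.trans e'.fP
  fT := e.fT.trans e'.fT
  σ_eq := by rw [e'.σ_eq, e.σ_eq]; rfl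
  τ_eq := by rw [e'.τ_eq, e.τ_eq]; rfl
  app_eq A := (e'.app_eq A).trans (e.app_eq (A ∘ e'.π))
  disc_eq i := by rw [e.disc_eq, e'.disc_eq]; rfl
  inp_eq t := by
    rw [Equiv.trans_apply, e'.inp_eq, e.inp_eq, ← Set.image_comp]; rfl
  out_eq t := by
    rw [Equiv.trans_apply, e'.out_eq, e.out_eq, ← Set.image_comp]; rfl
  left_eq j := by rw [Equiv.trans_apply, e.left_eq, e'.left_eq]
  right_eq j := by rw [Equiv.trans_apply, e.right_eq, e'.right_eq]
  index_eq x := by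
    have := e'.index_eq (Sum.map e.fP e.fT x)
    rw [Sum.map_map, e.index_eq] at this
    exact this

instance setoid (X Y : Obj B C) : Setoid (Tuple X Y) where
  r Φ Φ' := Nonempty (Equivalence Φ Φ')
  iseqv := ⟨fun Φ => ⟨.refl Φ⟩, fun ⟨e⟩ => ⟨e.symm⟩, fun ⟨e⟩ ⟨e'⟩ => ⟨e.trans e'⟩⟩

/-- The identity tuple: the net has the elements of `|α|` as places and no transitions. -/
def id (X : Obj B C) : Tuple X X where
  V := Fin X.arity.length
  trans :=
    { σ := _root_.id
      τ := _root_.id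
      app := fun _ => 𝟙 _ }
  graph :=
    { net :=
        { P := Fin X.arity.length
          T := Empty
          inp := fun t => t.elim
          out := fun t => t.elim }
      left := _root_.id
      right := _root_.id
      index := Sum.elim _root_.id (fun t => t.elim) }
  index_left _ := rfl
  index_right _ := rfl
  disc _ := true

/-- The standard graph of a transformation, whose places are the arguments of the two functors and
whose transitions are the variables. -/
def _root_.GenFun.Transformation.standardGraph {α β : List Variance} {V : Type} [Finite V]
    {F : MixedPow B α ⥤ C} {G : MixedPow B β ⥤ C} (φ : Transformation V F G) :
    NetCospan α β V where
  net :=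
    { P := Fin α.length ⊕ Fin β.length
      T := V
      inp := fun t => {p | (∃ j, φ.σ j = t ∧ α.get j = .plus ∧ Sum.inl j = p) ∨
        ∃ j, φ.τ j = t ∧ β.get j = .minus ∧ Sum.inr j = p}
      out := fun t => {p | (∃ j, φ.σ j = t ∧ α.get j = .minus ∧ Sum.inl j = p) ∨
        ∃ j, φ.τ j = t ∧ β.get j = .plus ∧ Sum.inr j = p} }
  left := Sum.inl
  right := Sum.inr
  index := Sum.elim (Sum.elim φ.σ φ.τ) _root_.id

/-- A transformation with its standard graph and a discriminant. -/
def standard {V : Type} [Finite V] (φ : Transformation V X.functor Y.functor) (Δ : V → Bool) :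
    Tuple X Y where
  V := V
  trans := φ
  graph := φ.standardGraph
  index_left _ := rfl
  index_right _ := rfl
  disc := Δ

open Classical in
/-- Composition of tuples (in diagrammatic order): pushout of the types, pushout of the nets, and
discriminant `1` exactly at those variables whose connected component in the composite net is
acyclic and that only come from variables of discriminant `1`. -/
noncomputable def comp (Φ : Tuple X Y) (Ψ : Tuple Y Z) : Tuple X Z :=
  haveI := Φ.finite_V
  haveI := Ψ.finite_V
  let graph : NetCospan X.arity Z.arity (Pushout Φ.trans.τ Ψ.trans.σ) :=
    { net := Φ.graph.net.glue Ψ.graph.net Φ.graph.right Ψ.graph.left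
      left := fun j => Pushout.inl (Φ.graph.left j)
      right := fun j => Pushout.inr (Ψ.graph.right j)
      index := Sum.elim
        (Pushout.desc (fun p => Pushout.inl (Φ.graph.index (Sum.inl p)))
          (fun p => Pushout.inr (Ψ.graph.index (Sum.inl p)))
          (fun j => by rw [Φ.index_right, Ψ.index_left]; exact Pushout.condition j))
        (Sum.elim (fun t => Pushout.inl (Φ.graph.index (Sum.inr t)))
          (fun t => Pushout.inr (Ψ.graph.index (Sum.inr t)))) }
  { V := Pushout Φ.trans.τ Ψ.trans.σ
    trans :=
      { σ := fun j => Pushout.inl (Φ.trans.σ j)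
        τ := fun j => Pushout.inr (Ψ.trans.τ j)
        app := fun A =>
          Φ.trans.app (fun v => A (Pushout.inl v)) ≫
            eqToHom (congrArg Y.functor.obj (funext fun j =>
              congrArg (fun D : B => Signed.mix (Y.arity.get j) D D)
                (congrArg A (Pushout.condition j)))) ≫
            Ψ.trans.app (fun v => A (Pushout.inr v)) }
    graph := graph
    index_left := fun j => congrArg Pushout.inl (Φ.index_left j)
    index_right := fun j => congrArg Pushout.inr (Ψ.index_right j)
    disc := fun x => decide (graph.AcyclicAt x ∧
      (∀ y, Pushout.inl y = x → Φ.disc y = true) ∧ ∀ z, Pushout.inr z = x → Ψ.disc z = true) }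

/-- The two ends agree and the tuple is equivalent to the identity tuple. -/
inductive IsIdentity : ∀ {X Y : Obj B C}, Tuple X Y → Prop
  | mk {X : Obj B C} {Φ : Tuple X X} : Φ ≈ Tuple.id X → IsIdentity Φ

/-- A net without transitions is only allowed in an identity. -/
def TrivialOnlyIdentity (Φ : Tuple X Y) : Prop :=
  IsEmpty Φ.graph.net.T → Φ.IsIdentity

/-- Atomic: the generalised graph is the standard graph. -/
structure IsAtomic (Φ : Tuple X Y) : Prop where
  valid : Φ.IsValid
  trivialOnlyIdentity : Φ.TrivialOnlyIdentity
  standard : ∃ (V : Type) (_ : Finite V) (φ : Transformation V X.functor Y.functor)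
    (Δ : V → Bool), Φ ≈ Tuple.standard φ Δ

/-- Composites `Φₖ ∘ ⋯ ∘ Φ₁` of `k ≥ 1` atomic tuples. -/
inductive IsCompositeOfAtomics : ∀ {X Y : Obj B C}, Tuple X Y → Prop
  | atomic {X Y : Obj B C} {Φ : Tuple X Y} : Φ.IsAtomic → IsCompositeOfAtomics Φ
  | comp {X Y Z : Obj B C} {Φ : Tuple X Y} {Ψ : Tuple Y Z} :
      IsCompositeOfAtomics Φ → Ψ.IsAtomic → IsCompositeOfAtomics (Φ.comp Ψ)

/-- The tuples that represent morphisms of the generalised functor category. -/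
structure IsMorphism (Φ : Tuple X Y) : Prop where
  valid : Φ.IsValid
  trivialOnlyIdentity : Φ.TrivialOnlyIdentity
  composite : ¬ Φ.IsAtomic → ¬ Φ.IsIdentity → ∃ Ψ : Tuple X Y, Ψ.IsCompositeOfAtomics ∧ Φ ≈ Ψ

end Tuple

/-- Morphisms of `{B, C}`: equivalence classes of tuples. -/
def Hom (X Y : Obj B C) : Type (max 1 u₁ v₂) :=
  Quotient ((Tuple.setoid X Y).comap (Subtype.val : {Φ : Tuple X Y // Φ.IsMorphism} → Tuple X Y))

/-- The class of a tuple. -/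
def Hom.mk {X Y : Obj B C} (Φ : Tuple X Y) (h : Φ.IsMorphism) : Hom X Y :=
  Quotient.mk _ ⟨Φ, h⟩

end

end GenFun

/-! The only deep point is dinaturality of a composite. Dinatural transformations do not compose in
general, and dinaturality of the two factors is too coarse a hypothesis to work with: one must be
able to interleave their hexagons. The remedy is to remember how a morphism is built from atomic
ones. Every morphism that is not an identity is, up to equivalence, a composite of tuples with
standard graphs, whose transitions are single variables of atomic transformations.

For such a composite the transitions are treated as independent variables. Given `f : X ⟶ Y` and a
set of fired transitions, evaluate each fired transition at `X` and each unfired one at `Y`. At a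
glued place the producing and the consuming transition may then disagree, and `f` bridges the gap in
the right direction exactly when the set contains all causes of its elements (`Closed`,
`Refinement.argsLE_middle`). This gives a morphism for every closed set, and firing one more
transition of discriminant `1` is one hexagon of one atomic factor (`Refinement.compApp_hexagon`).
If component `i` is acyclic, its transitions can be fired one by one in a causal order. The hexagons
paste (`DiagHexagon.trans`, `Refinement.diagHexagon_of_acyclic`), and the pasted hexagon, from
nothing fired in component `i` to everything fired, is dinaturality of the composite in `i`
(`Refinement.dinaturalAt`).

Coherence is kept trivial by taking all arguments from diagrams on a preorder of stages, so that
parallel comparison maps are equal. The rest is combinatorial: pushouts are associative, unital and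
invariant under equivalence (`Tuple.comp_assoc`, `Tuple.id_comp`, `Tuple.comp_id`,
`Tuple.comp_congr`), and gluing preserves the conditions on graphs (`Tuple.comp_isGraph`).
Identities are not composites of atomic tuples and are treated separately by the unit laws. -/

namespace GenFun

/-! ### Pushouts -/

namespace Pushout

variable {S X Y : Type} {f : S → X} {g : S → Y}

theorem ind {motive : Pushout f g → Prop} (hl : ∀ x, motive (inl x)) (hr : ∀ y, motive (inr y))
    (q : Pushout f g) : motive q := by
  induction q using Quot.ind with
  | mk a => cases a with
    | inl x => exact hl x
    | inr y => exact hr y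

theorem exists_inl_or_inr (q : Pushout f g) : (∃ x, q = inl x) ∨ ∃ y, q = inr y := by
  induction q using ind with
  | hl x => exact .inl ⟨x, rfl⟩
  | hr y => exact .inr ⟨y, rfl⟩

/-- The fibre of `inl x` is described by an explicit predicate on both summands. It descends to the
quotient because `g` is injective, and so separates `inl x` from the other points. -/
theorem inl_injective (hg : Function.Injective g) :
    Function.Injective (inl : X → Pushout f g) := by
  intro x x' h
  let d : Pushout f g → Prop := desc (fun z => z = x) (fun y => ∃ s, f s = x ∧ g s = y)
    (fun s => propext ⟨fun hs => ⟨s, hs, rfl⟩, fun ⟨_, h1, h2⟩ => hg h2 ▸ h1⟩)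
  have hd : d (inl x) = d (inl x') := congrArg d h
  exact (cast hd (rfl : x = x) : x' = x).symm

theorem inr_injective (hf : Function.Injective f) :
    Function.Injective (inr : Y → Pushout f g) := by
  intro y y' h
  let d : Pushout f g → Prop := desc (fun x => ∃ s, g s = y ∧ f s = x) (fun z => z = y)
    (fun s => propext ⟨fun ⟨_, h1, h2⟩ => hf h2 ▸ h1, fun hs => ⟨s, hs, rfl⟩⟩)
  have hd : d (inr y) = d (inr y') := congrArg d h
  exact (cast hd (rfl : y = y) : y' = y).symm

theorem exists_of_inl_eq_inr (hg : Function.Injective g) {x : X} {y : Y}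
    (h : (inl x : Pushout f g) = inr y) : ∃ s, f s = x ∧ g s = y := by
  let d : Pushout f g → Prop := desc (fun z => z = x) (fun y => ∃ s, f s = x ∧ g s = y)
    (fun s => propext ⟨fun hs => ⟨s, hs, rfl⟩, fun ⟨_, h1, h2⟩ => hg h2 ▸ h1⟩)
  have hd : d (inl x) = d (inr y) := congrArg d h
  exact cast hd (rfl : x = x)

/-- Functoriality of the pushout with respect to bijections of the two legs. -/
def congr {X' Y' : Type} {f' : S → X'} {g' : S → Y'} (eX : X ≃ X') (eY : Y ≃ Y')
    (hf : ∀ s, eX (f s) = f' s) (hg : ∀ s, eY (g s) = g' s) : Pushout f g ≃ Pushout f' g' where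
  toFun := desc (fun x => inl (eX x)) (fun y => inr (eY y))
    (fun s => by rw [hf, hg]; exact condition s)
  invFun := desc (fun x => inl (eX.symm x)) (fun y => inr (eY.symm y))
    (fun s => by rw [← hf, ← hg]; simpa using condition s)
  left_inv q := by
    induction q using ind with
    | hl x => exact congrArg inl (eX.symm_apply_apply x)
    | hr y => exact congrArg inr (eY.symm_apply_apply y)
  right_inv q := by
    induction q using ind with
    | hl x => exact congrArg inl (eX.apply_symm_apply x)
    | hr y => exact congrArg inr (eY.apply_symm_apply y)

/-- Associativity of iterated pushouts. -/
def assoc {S' Z : Type} (f : S → X) (g : S → Y) (h : S' → Y) (k : S' → Z) :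
    Pushout (fun s => (inr (h s) : Pushout f g)) k ≃
      Pushout f (fun s => (inl (g s) : Pushout h k)) where
  toFun := desc (desc inl (fun y => inr (inl y)) (fun s => condition s)) (fun z => inr (inr z))
    (fun s => congrArg inr (condition s))
  invFun := desc (fun x => inl (inl x)) (desc (fun y => inl (inr y)) inr (fun s => condition s))
    (fun s => congrArg inl (condition s))
  left_inv q := by
    induction q using ind with
    | hl x => induction x using ind with
      | hl x => rfl
      | hr y => rfl
    | hr y => rfl
  right_inv q := by
    induction q using ind with
    | hl x => rfl
    | hr y => induction y using ind with
      | hl x => rfl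
      | hr y => rfl

/-- The pushout along an identity on the left. -/
def idLeft (g : S → Y) : Pushout _root_.id g ≃ Y where
  toFun := desc g _root_.id (fun _ => rfl)
  invFun := inr
  left_inv q := by
    induction q using ind with
    | hl x => exact (condition x).symm
    | hr y => rfl
  right_inv _ := rfl

/-- The pushout along an identity on the right. -/
def idRight (f : S → X) : Pushout f _root_.id ≃ X where
  toFun := desc _root_.id f (fun _ => rfl)
  invFun := inl
  left_inv q := by
    induction q using ind with
    | hl x => rfl
    | hr y => exact condition y
  right_inv _ := rfl

end Pushout

/-! ### Isomorphisms and inclusions of nets -/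

namespace PetriNet

theorem OnCycle.map {N N' : PetriNet} (fP : N.P → N'.P) (fT : N.T → N'.T)
    (hi : ∀ t p, p ∈ N.inp t → fP p ∈ N'.inp (fT t))
    (ho : ∀ t p, p ∈ N.out t → fP p ∈ N'.out (fT t)) {x : N.Vertex} (h : N.OnCycle x) :
    N'.OnCycle (Sum.map fP fT x) := by
  refine Relation.TransGen.lift (Sum.map fP fT) ?_ _ _ h
  rintro _ _ (h | h)
  · exact .inp (hi _ _ h)
  · exact .out (ho _ _ h)

theorem Connected.map {N N' : PetriNet} (fP : N.P → N'.P) (fT : N.T → N'.T)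
    (hi : ∀ t p, p ∈ N.inp t → fP p ∈ N'.inp (fT t))
    (ho : ∀ t p, p ∈ N.out t → fP p ∈ N'.out (fT t)) {x y : N.Vertex} (h : N.Connected x y) :
    N'.Connected (Sum.map fP fT x) (Sum.map fP fT y) := by
  induction h with
  | rel _ _ h =>
    refine .rel _ _ ?_
    rcases h with h | h
    · exact .inp (hi _ _ h)
    · exact .out (ho _ _ h)
  | refl => exact .refl _
  | symm _ _ _ ih => exact ih.symm
  | trans _ _ _ _ _ ih ih' => exact ih.trans _ _ _ ih'

theorem onCycle_glue_inl {N N' : PetriNet} {S : Type} {ρ : S → N.P} {l : S → N'.P}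
    {x : N.Vertex} (h : N.OnCycle x) :
    (N.glue N' ρ l).OnCycle (Sum.map Pushout.inl Sum.inl x) :=
  OnCycle.map (N' := N.glue N' ρ l) Pushout.inl Sum.inl (fun _ p hp => ⟨p, hp, rfl⟩)
    (fun _ p hp => ⟨p, hp, rfl⟩) h

theorem onCycle_glue_inr {N N' : PetriNet} {S : Type} {ρ : S → N.P} {l : S → N'.P}
    {x : N'.Vertex} (h : N'.OnCycle x) :
    (N.glue N' ρ l).OnCycle (Sum.map Pushout.inr Sum.inr x) :=
  OnCycle.map (N' := N.glue N' ρ l) Pushout.inr Sum.inr (fun _ p hp => ⟨p, hp, rfl⟩)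
    (fun _ p hp => ⟨p, hp, rfl⟩) h

theorem connected_glue_inl {N N' : PetriNet} {S : Type} {ρ : S → N.P} {l : S → N'.P}
    {x y : N.Vertex} (h : N.Connected x y) :
    (N.glue N' ρ l).Connected (Sum.map Pushout.inl Sum.inl x) (Sum.map Pushout.inl Sum.inl y) :=
  Connected.map (N' := N.glue N' ρ l) Pushout.inl Sum.inl (fun _ p hp => ⟨p, hp, rfl⟩)
    (fun _ p hp => ⟨p, hp, rfl⟩) h

theorem connected_glue_inr {N N' : PetriNet} {S : Type} {ρ : S → N.P} {l : S → N'.P}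
    {x y : N'.Vertex} (h : N'.Connected x y) :
    (N.glue N' ρ l).Connected (Sum.map Pushout.inr Sum.inr x) (Sum.map Pushout.inr Sum.inr y) :=
  Connected.map (N' := N.glue N' ρ l) Pushout.inr Sum.inr (fun _ p hp => ⟨p, hp, rfl⟩)
    (fun _ p hp => ⟨p, hp, rfl⟩) h

end PetriNet

section

variable {B : Type u₁} [Category.{v₁} B] {C : Type u₂} [Category.{v₂} C]

/-! ### Dinaturality along arbitrary families -/

/-- The hexagon of a transformation for a family of morphisms, one for each variable. -/
def Transformation.Hexagon {α β : List Variance} {V : Type} {F : MixedPow B α ⥤ C}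
    {G : MixedPow B β ⥤ C} (φ : Transformation V F G) {P Q : V → B} (h : ∀ v, P v ⟶ Q v) : Prop :=
  F.map (argsMap h (fun v => 𝟙 (P v)) φ.σ) ≫ φ.app P ≫
      G.map (argsMap (fun v => 𝟙 (P v)) h φ.τ) =
    F.map (argsMap (fun v => 𝟙 (Q v)) h φ.σ) ≫ φ.app Q ≫
      G.map (argsMap h (fun v => 𝟙 (Q v)) φ.τ)

theorem subst_self {B : Type u₁} {V : Type} (A : V → B) (i : V) (X : B) : subst A i X i = X := if_pos rfl

theorem subst_of_ne {B : Type u₁} {V : Type} (A : V → B) {i v : V} (X Y : B) (h : v ≠ i) :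
    subst A i X v = subst A i Y v := (if_neg h).trans (if_neg h).symm

theorem substHom_self {V : Type} (A : V → B) (i : V) {X Y : B} (f : X ⟶ Y) :
    substHom A i f i = eqToHom (subst_self A i X) ≫ f ≫ eqToHom (subst_self A i Y).symm :=
  dif_pos rfl

theorem substHom_of_ne {V : Type} (A : V → B) (i : V) {X Y : B} (f : X ⟶ Y) {v : V} (h : v ≠ i) :
    substHom A i f v = eqToHom (subst_of_ne A X Y h) :=
  dif_neg h

/-- `subst` and `substHom` do not reindex well. Families that are identities away from `i`, up to
equality of objects, can be reindexed along a bijection of variables and recognised in a diagram. -/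
theorem Transformation.dinaturalAt_iff {α β : List Variance} {V : Type} {F : MixedPow B α ⥤ C}
    {G : MixedPow B β ⥤ C} (φ : Transformation V F G) (i : V) :
    φ.DinaturalAt i ↔ ∀ (P Q : V → B) (h : ∀ v, P v ⟶ Q v),
      (∀ v, v ≠ i → ∃ e : P v = Q v, h v = eqToHom e) → φ.Hexagon h := by
  constructor
  · intro H P Q h hh
    have key : ∃ (A : V → B) (X Y : B) (f : X ⟶ Y), ∃ (hP : P = subst A i X)
        (hQ : Q = subst A i Y), ∀ v, h v =
          eqToHom (congrFun hP v) ≫ substHom A i f v ≫ eqToHom (congrFun hQ v).symm := by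
      refine ⟨P, P i, Q i, h i, ?_, ?_, ?_⟩
      · funext v
        by_cases hv : v = i
        · subst hv; simp [subst]
        · simp [subst, hv]
      · funext v
        by_cases hv : v = i
        · subst hv; simp [subst]
        · simp [subst, hv, (hh v hv).1]
      · intro v
        by_cases hv : v = i
        · subst hv; simp [substHom_self]
        · obtain ⟨e, he⟩ := hh v hv
          simp [substHom_of_ne _ _ _ hv, he]
    obtain ⟨A, X, Y, f, rfl, rfl, hf⟩ := key
    obtain rfl : h = substHom A i f := by
      funext v
      simpa using hf v
    exact H A f
  · intro H A X Y f
    refine H _ _ (substHom A i f) fun v hv => ?_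
    exact ⟨subst_of_ne A X Y hv, substHom_of_ne _ _ _ hv⟩

theorem heq_comp_eqToHom_comp {a b c d a' b' c' d' : C} (ha : a = a') (hb : b = b') (hc : c = c')
    (hd : d = d') {f : a ⟶ b} {g : c ⟶ d} {f' : a' ⟶ b'} {g' : c' ⟶ d'} (hf : HEq f f')
    (hg : HEq g g') (h : b = c) (h' : b' = c') :
    HEq (f ≫ eqToHom h ≫ g) (f' ≫ eqToHom h' ≫ g') := by
  subst ha hb hc hd
  obtain rfl := eq_of_heq hf
  obtain rfl := eq_of_heq hg
  rfl

namespace Tuple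

variable {X Y Z W : Obj B C}

/-! ### Invariance under equivalence -/

namespace Equivalence

variable {Φ Φ' : Tuple X Y}

theorem mem_inp (e : Equivalence Φ Φ') (t p) :
    e.fP p ∈ Φ'.graph.net.inp (e.fT t) ↔ p ∈ Φ.graph.net.inp t := by
  rw [e.inp_eq, e.fP.injective.mem_set_image]

theorem mem_out (e : Equivalence Φ Φ') (t p) :
    e.fP p ∈ Φ'.graph.net.out (e.fT t) ↔ p ∈ Φ.graph.net.out t := by
  rw [e.out_eq, e.fP.injective.mem_set_image]

theorem acyclicAt (e : Equivalence Φ Φ') {i : Φ.V} (h : Φ.graph.AcyclicAt i) :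
    Φ'.graph.AcyclicAt (e.π i) := by
  intro x hx hc
  refine h (Sum.map e.fP.symm e.fT.symm x) ?_ (PetriNet.OnCycle.map _ _ ?_ ?_ hc)
  · refine (e.symm.index_eq x).trans ?_
    rw [hx]
    exact e.π.symm_apply_apply i
  · exact fun t p hp => (e.symm.mem_inp t p).2 hp
  · exact fun t p hp => (e.symm.mem_out t p).2 hp

theorem acyclicAt_iff (e : Equivalence Φ Φ') (i : Φ.V) :
    Φ'.graph.AcyclicAt (e.π i) ↔ Φ.graph.AcyclicAt i := by
  refine ⟨fun h => ?_, e.acyclicAt⟩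
  have := e.symm.acyclicAt h
  rwa [show e.symm.π (e.π i) = i from e.π.symm_apply_apply i] at this

theorem dinaturalAt (e : Equivalence Φ Φ') {i : Φ.V} (h : Φ.trans.DinaturalAt i) :
    Φ'.trans.DinaturalAt (e.π i) := by
  rw [Transformation.dinaturalAt_iff] at h ⊢
  intro P Q k hk
  have H := h (P ∘ e.π) (Q ∘ e.π) (fun v => k (e.π v))
    (fun v hv => hk _ (fun hv' => hv (e.π.injective hv')))
  have hσ := e.σ_eq
  have hτ := e.τ_eq
  have happ := e.app_eq
  -- Once the transformation is a free variable its type functions can be substituted, which turns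
  -- the heterogeneous equalities of components into ordinary ones.
  generalize Φ'.trans = ψ at hσ hτ happ ⊢
  obtain ⟨σ', τ', app'⟩ := ψ
  dsimp only at hσ hτ
  subst hσ hτ
  have h1 : app' P = Φ.trans.app (P ∘ e.π) := eq_of_heq (happ P)
  have h2 : app' Q = Φ.trans.app (Q ∘ e.π) := eq_of_heq (happ Q)
  unfold Transformation.Hexagon at H ⊢
  dsimp only
  rw [h1, h2]
  exact H

theorem connected_iff (e : Equivalence Φ Φ') (x y) :
    Φ'.graph.net.Connected (Sum.map e.fP e.fT x) (Sum.map e.fP e.fT y) ↔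
      Φ.graph.net.Connected x y := by
  constructor
  · intro h
    have := PetriNet.Connected.map (N' := Φ.graph.net) e.fP.symm e.fT.symm
      (fun t p hp => (e.symm.mem_inp t p).2 hp) (fun t p hp => (e.symm.mem_out t p).2 hp) h
    simpa [Sum.map_map] using this
  · exact PetriNet.Connected.map e.fP e.fT
      (fun t p hp => (e.mem_inp t p).2 hp) (fun t p hp => (e.mem_out t p).2 hp)

theorem isGraph (e : Equivalence Φ Φ') (h : Φ.graph.IsGraph) : Φ'.graph.IsGraph := by
  have hi : ∀ t p, p ∈ Φ'.graph.net.inp t ↔ e.fP.symm p ∈ Φ.graph.net.inp (e.fT.symm t) :=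
    fun t p => (e.symm.mem_inp t p).symm
  have ho : ∀ t p, p ∈ Φ'.graph.net.out t ↔ e.fP.symm p ∈ Φ.graph.net.out (e.fT.symm t) :=
    fun t p => (e.symm.mem_out t p).symm
  have hl : ∀ j, Φ'.graph.left j = e.fP (Φ.graph.left j) := fun j => (e.left_eq j).symm
  have hr : ∀ j, Φ'.graph.right j = e.fP (Φ.graph.right j) := fun j => (e.right_eq j).symm
  refine ⟨⟨?_, ?_⟩, ?_, ?_, ?_, ?_, ?_, ?_, ?_⟩
  · intro p t t' h1 h2
    rw [hi] at h1 h2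
    exact e.fT.symm.injective (h.fbcf.1 _ _ _ h1 h2)
  · intro p t t' h1 h2
    rw [ho] at h1 h2
    exact e.fT.symm.injective (h.fbcf.2 _ _ _ h1 h2)
  · intro t p hp
    rw [hi, ho] at hp
    exact h.noSelfLoop _ _ hp
  · intro j k hjk
    rw [hl, hl] at hjk
    exact h.left_injective (e.fP.injective hjk)
  · intro j k hjk
    rw [hr, hr] at hjk
    exact h.right_injective (e.fP.injective hjk)
  · ext p
    have := Set.ext_iff.1 h.sources_eq (e.fP.symm p)
    simp only [PetriNet.sources, Set.mem_ofPred_eq, Equiv.eq_symm_apply] at this ⊢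
    simp only [ho, hl, hr, ← this]
    exact e.fT.symm.forall_congr_left (p := fun t => e.fP.symm p ∉ Φ.graph.net.out (e.fT.symm t))
      |>.trans (by simp)
  · ext p
    have := Set.ext_iff.1 h.sinks_eq (e.fP.symm p)
    simp only [PetriNet.sinks, Set.mem_ofPred_eq, Equiv.eq_symm_apply] at this ⊢
    simp only [hi, hl, hr, ← this]
    exact e.fT.symm.forall_congr_left (p := fun t => e.fP.symm p ∉ Φ.graph.net.inp (e.fT.symm t))
      |>.trans (by simp)
  · intro x y
    rw [← e.symm.connected_iff, ← h.index_eq_iff, e.symm.index_eq x, e.symm.index_eq y]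
    exact e.π.symm.injective.eq_iff.symm
  · intro v
    obtain ⟨x, hx⟩ := h.index_surjective (e.π.symm v)
    exact ⟨Sum.map e.fP e.fT x, by rw [e.index_eq, hx]; simp⟩

theorem isValid (e : Equivalence Φ Φ') (h : Φ.IsValid) : Φ'.IsValid where
  isGraph := e.isGraph h.isGraph
  disc_spec i hi := by
    obtain ⟨i, rfl⟩ := e.π.surjective i
    rw [← e.disc_eq] at hi
    exact ⟨e.acyclicAt (h.disc_spec i hi).1, e.dinaturalAt (h.disc_spec i hi).2⟩

end Equivalence

theorem IsIdentity.of_equiv {Φ Φ' : Tuple X Y} (h : Φ ≈ Φ') (hΦ : Φ.IsIdentity) :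
    Φ'.IsIdentity := by
  cases hΦ with
  | mk h' => exact .mk (Setoid.trans (Setoid.symm h) h')

theorem TrivialOnlyIdentity.of_equiv {Φ Φ' : Tuple X Y} (h : Φ ≈ Φ')
    (hΦ : Φ.TrivialOnlyIdentity) : Φ'.TrivialOnlyIdentity := by
  intro hT
  have ⟨e⟩ := h
  exact (hΦ e.fT.isEmpty).of_equiv h

theorem IsAtomic.of_equiv {Φ Φ' : Tuple X Y} (h : Φ ≈ Φ') (hΦ : Φ.IsAtomic) : Φ'.IsAtomic where
  valid := h.elim fun e => e.isValid hΦ.valid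
  trivialOnlyIdentity := hΦ.trivialOnlyIdentity.of_equiv h
  standard := by
    obtain ⟨V, hV, φ, Δ, h'⟩ := hΦ.standard
    exact ⟨V, hV, φ, Δ, Setoid.trans (Setoid.symm h) h'⟩

theorem IsMorphism.of_equiv {Φ Φ' : Tuple X Y} (h : Φ ≈ Φ') (hΦ : Φ.IsMorphism) :
    Φ'.IsMorphism where
  valid := h.elim fun e => e.isValid hΦ.valid
  trivialOnlyIdentity := hΦ.trivialOnlyIdentity.of_equiv h
  composite h1 h2 := by
    obtain ⟨Ψ, hΨ, h'⟩ := hΦ.composite (fun H => h1 (H.of_equiv h)) (fun H => h2 (H.of_equiv h))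
    exact ⟨Ψ, hΨ, Setoid.trans (Setoid.symm h) h'⟩

/-! ### Composition: congruence, associativity, units -/

theorem comp_disc_eq_true {Φ : Tuple X Y} {Ψ : Tuple Y Z} (x : (Φ.comp Ψ).V) :
    (Φ.comp Ψ).disc x = true ↔ (Φ.comp Ψ).graph.AcyclicAt x ∧
      (∀ y, Pushout.inl y = x → Φ.disc y = true) ∧ ∀ z, Pushout.inr z = x → Ψ.disc z = true := by
  simp only [comp, decide_eq_true_eq]

/-- An equivalence of tuples from data that respect everything but possibly the discriminants,
which are only compared under the hypothesis that acyclic components correspond. -/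
def Equivalence.ofData {Φ Φ' : Tuple X Y} (π : Φ.V ≃ Φ'.V)
    (fP : Φ.graph.net.P ≃ Φ'.graph.net.P) (fT : Φ.graph.net.T ≃ Φ'.graph.net.T)
    (σ_eq : Φ'.trans.σ = π ∘ Φ.trans.σ) (τ_eq : Φ'.trans.τ = π ∘ Φ.trans.τ)
    (app_eq : ∀ A : Φ'.V → B, HEq (Φ'.trans.app A) (Φ.trans.app (A ∘ π)))
    (inp_eq : ∀ t, Φ'.graph.net.inp (fT t) = fP '' Φ.graph.net.inp t)
    (out_eq : ∀ t, Φ'.graph.net.out (fT t) = fP '' Φ.graph.net.out t)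
    (left_eq : ∀ j, fP (Φ.graph.left j) = Φ'.graph.left j)
    (right_eq : ∀ j, fP (Φ.graph.right j) = Φ'.graph.right j)
    (index_eq : ∀ x, Φ'.graph.index (Sum.map fP fT x) = π (Φ.graph.index x))
    (disc_iff : (∀ i, Φ'.graph.AcyclicAt (π i) ↔ Φ.graph.AcyclicAt i) →
      ∀ i, Φ.disc i = true ↔ Φ'.disc (π i) = true) : Equivalence Φ Φ' where
  π := π
  fP := fP
  fT := fT
  σ_eq := σ_eq
  τ_eq := τ_eq
  app_eq := app_eq
  disc_eq i := by
    -- With the discriminant pulled back from `Φ'`, the data already form an equivalence, so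
    -- invariance of acyclicity is available before the true discriminants are compared.
    let Ψ : Tuple X Y := { Φ with disc := fun i => Φ'.disc (π i) }
    let e : Equivalence Ψ Φ' :=
      ⟨π, fP, fT, σ_eq, τ_eq, app_eq, fun _ => rfl, inp_eq, out_eq, left_eq, right_eq, index_eq⟩
    exact Bool.eq_iff_iff.2 (disc_iff e.acyclicAt_iff i)
  inp_eq := inp_eq
  out_eq := out_eq
  left_eq := left_eq
  right_eq := right_eq
  index_eq := index_eq

theorem app_congr {Φ Φ' : Tuple X Y} (e : Equivalence Φ Φ') (A : Φ'.V → B) :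
    args A A Φ'.trans.σ = args (A ∘ e.π) (A ∘ e.π) Φ.trans.σ ∧
      args A A Φ'.trans.τ = args (A ∘ e.π) (A ∘ e.π) Φ.trans.τ := by
  rw [e.σ_eq, e.τ_eq]
  exact ⟨rfl, rfl⟩

theorem comp_congr {Φ Φ' : Tuple X Y} {Ψ Ψ' : Tuple Y Z} (h : Φ ≈ Φ') (h' : Ψ ≈ Ψ') :
    Φ.comp Ψ ≈ Φ'.comp Ψ' := by
  obtain ⟨e⟩ := h
  obtain ⟨e'⟩ := h'
  refine ⟨Equivalence.ofData
    (Pushout.congr e.π e'.π (fun s => (congrFun e.τ_eq s).symm) (fun s => (congrFun e'.σ_eq s).symm))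
    (Pushout.congr e.fP e'.fP e.right_eq e'.left_eq) (Equiv.sumCongr e.fT e'.fT)
    ?_ ?_ ?_ ?_ ?_ ?_ ?_ ?_ ?_⟩
  · funext j
    exact congrArg Pushout.inl (congrFun e.σ_eq j)
  · funext j
    exact congrArg Pushout.inr (congrFun e'.τ_eq j)
  · intro A
    have h1 := app_congr e (fun v => A (Pushout.inl v))
    have h2 := app_congr e' (fun v => A (Pushout.inr v))
    exact heq_comp_eqToHom_comp (congrArg _ h1.1) (congrArg _ h1.2) (congrArg _ h2.1)
      (congrArg _ h2.2) (e.app_eq _) (e'.app_eq _) _ _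
  · rintro (t | t)
    · refine (congrArg (Set.image Pushout.inl) (e.inp_eq t)).trans ?_
      refine Eq.trans ?_ (Set.image_comp _ _ _)
      exact (Set.image_comp _ _ _).symm
    · refine (congrArg (Set.image Pushout.inr) (e'.inp_eq t)).trans ?_
      refine Eq.trans ?_ (Set.image_comp _ _ _)
      exact (Set.image_comp _ _ _).symm
  · rintro (t | t)
    · refine (congrArg (Set.image Pushout.inl) (e.out_eq t)).trans ?_
      refine Eq.trans ?_ (Set.image_comp _ _ _)
      exact (Set.image_comp _ _ _).symm
    · refine (congrArg (Set.image Pushout.inr) (e'.out_eq t)).trans ?_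
      refine Eq.trans ?_ (Set.image_comp _ _ _)
      exact (Set.image_comp _ _ _).symm
  · exact fun j => congrArg Pushout.inl (e.left_eq j)
  · exact fun j => congrArg Pushout.inr (e'.right_eq j)
  · rintro (p | t | t)
    · induction p using Pushout.ind with
      | hl p => exact congrArg Pushout.inl (e.index_eq (Sum.inl p))
      | hr p => exact congrArg Pushout.inr (e'.index_eq (Sum.inl p))
    · exact congrArg Pushout.inl (e.index_eq (Sum.inr t))
    · exact congrArg Pushout.inr (e'.index_eq (Sum.inr t))
  · intro hac x
    rw [comp_disc_eq_true, comp_disc_eq_true, hac]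
    refine and_congr_right fun _ => and_congr ?_ ?_
    · refine e.π.forall_congr fun y => ?_
      rw [e.disc_eq]
      refine imp_congr_left ?_
      exact ((Pushout.congr e.π e'.π (fun s => (congrFun e.τ_eq s).symm)
        (fun s => (congrFun e'.σ_eq s).symm)).injective.eq_iff (a := Pushout.inl y) (b := x)).symm
    · refine e'.π.forall_congr fun y => ?_
      rw [e'.disc_eq]
      refine imp_congr_left ?_
      exact ((Pushout.congr e.π e'.π (fun s => (congrFun e.τ_eq s).symm)
        (fun s => (congrFun e'.σ_eq s).symm)).injective.eq_iff (a := Pushout.inr y) (b := x)).symm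

/-- A cycle in a factor survives in the glued net. This is what makes the discriminant associative:
acyclicity of the total net implies the condition imposed at the intermediate composite. -/
theorem comp_acyclicAt_inl {Φ : Tuple X Y} {Ψ : Tuple Y Z} {y : Φ.V}
    (h : (Φ.comp Ψ).graph.AcyclicAt (Pushout.inl y)) : Φ.graph.AcyclicAt y := by
  rintro x rfl hc
  refine h _ ?_ (PetriNet.onCycle_glue_inl hc)
  cases x <;> rfl

theorem comp_acyclicAt_inr {Φ : Tuple X Y} {Ψ : Tuple Y Z} {y : Ψ.V}
    (h : (Φ.comp Ψ).graph.AcyclicAt (Pushout.inr y)) : Ψ.graph.AcyclicAt y := by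
  rintro x rfl hc
  refine h _ ?_ (PetriNet.onCycle_glue_inr hc)
  cases x <;> rfl

theorem comp_assoc (Φ : Tuple X Y) (Ψ : Tuple Y Z) (Ω : Tuple Z W) :
    (Φ.comp Ψ).comp Ω ≈ Φ.comp (Ψ.comp Ω) := by
  refine ⟨Equivalence.ofData
    (Pushout.assoc Φ.trans.τ Ψ.trans.σ Ψ.trans.τ Ω.trans.σ)
    (Pushout.assoc Φ.graph.right Ψ.graph.left Ψ.graph.right Ω.graph.left)
    (Equiv.sumAssoc _ _ _) rfl rfl ?_ ?_ ?_ (fun _ => rfl) (fun _ => rfl) ?_ ?_⟩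
  · intro A
    refine heq_of_eq ?_
    exact Eq.symm ((Category.assoc _ _ _).trans (congrArg _ (Category.assoc _ _ _)))
  · rintro ((t | t) | t)
    · refine Set.Subset.antisymm ?_ ?_
      · rintro _ ⟨q, hq, rfl⟩
        exact ⟨_, ⟨_, ⟨q, hq, rfl⟩, rfl⟩, rfl⟩
      · rintro _ ⟨_, ⟨_, ⟨q, hq, rfl⟩, rfl⟩, rfl⟩
        exact ⟨q, hq, rfl⟩
    · refine Set.Subset.antisymm ?_ ?_
      · rintro _ ⟨_, ⟨q, hq, rfl⟩, rfl⟩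
        exact ⟨_, ⟨_, ⟨q, hq, rfl⟩, rfl⟩, rfl⟩
      · rintro _ ⟨_, ⟨_, ⟨q, hq, rfl⟩, rfl⟩, rfl⟩
        exact ⟨_, ⟨q, hq, rfl⟩, rfl⟩
    · refine Set.Subset.antisymm ?_ ?_
      · rintro _ ⟨_, ⟨q, hq, rfl⟩, rfl⟩
        exact ⟨_, ⟨q, hq, rfl⟩, rfl⟩
      · rintro _ ⟨_, ⟨q, hq, rfl⟩, rfl⟩
        exact ⟨_, ⟨q, hq, rfl⟩, rfl⟩
  · rintro ((t | t) | t)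
    · refine Set.Subset.antisymm ?_ ?_
      · rintro _ ⟨q, hq, rfl⟩
        exact ⟨_, ⟨_, ⟨q, hq, rfl⟩, rfl⟩, rfl⟩
      · rintro _ ⟨_, ⟨_, ⟨q, hq, rfl⟩, rfl⟩, rfl⟩
        exact ⟨q, hq, rfl⟩
    · refine Set.Subset.antisymm ?_ ?_
      · rintro _ ⟨_, ⟨q, hq, rfl⟩, rfl⟩
        exact ⟨_, ⟨_, ⟨q, hq, rfl⟩, rfl⟩, rfl⟩
      · rintro _ ⟨_, ⟨_, ⟨q, hq, rfl⟩, rfl⟩, rfl⟩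
        exact ⟨_, ⟨q, hq, rfl⟩, rfl⟩
    · refine Set.Subset.antisymm ?_ ?_
      · rintro _ ⟨_, ⟨q, hq, rfl⟩, rfl⟩
        exact ⟨_, ⟨q, hq, rfl⟩, rfl⟩
      · rintro _ ⟨_, ⟨q, hq, rfl⟩, rfl⟩
        exact ⟨_, ⟨q, hq, rfl⟩, rfl⟩
  · rintro (p | (t | t) | t)
    · induction p using Pushout.ind with
      | hl p => induction p using Pushout.ind with
        | hl p => rfl
        | hr p => rfl
      | hr p => rfl
    · rfl
    · rfl
    · rfl
  · intro hac x
    rw [comp_disc_eq_true, comp_disc_eq_true, hac]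
    refine and_congr_right fun hx => ?_
    have hinj := (Pushout.assoc Φ.trans.τ Ψ.trans.σ Ψ.trans.τ Ω.trans.σ).injective
    have hx' := (hac x).2 hx
    constructor
    · rintro ⟨h1, h2⟩
      refine ⟨fun y hy => ?_, fun z hz => (comp_disc_eq_true z).2 ⟨?_, fun y hy => ?_, fun y hy => ?_⟩⟩
      · exact ((comp_disc_eq_true _).1 (h1 (Pushout.inl y) (hinj hy))).2.1 y rfl
      · rw [← hz] at hx'
        exact comp_acyclicAt_inr hx'
      · subst hy
        exact ((comp_disc_eq_true _).1 (h1 (Pushout.inr y) (hinj hz))).2.2 y rfl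
      · subst hy
        exact h2 y (hinj hz)
    · rintro ⟨h1, h2⟩
      refine ⟨fun z hz => (comp_disc_eq_true z).2 ⟨?_, fun y hy => ?_, fun y hy => ?_⟩, fun z hz => ?_⟩
      · rw [← hz] at hx
        exact comp_acyclicAt_inl hx
      · subst hy hz
        exact h1 y rfl
      · subst hy hz
        exact ((comp_disc_eq_true _).1 (h2 (Pushout.inl y) rfl)).2.1 y rfl
      · subst hz
        exact ((comp_disc_eq_true _).1 (h2 (Pushout.inr z) rfl)).2.2 z rfl

/-- Composition resets the discriminant to `0` on cyclic components. Validity guarantees that it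
already vanished there. -/
theorem id_comp {Φ : Tuple X Y} (hΦ : Φ.IsValid) : (Tuple.id X).comp Φ ≈ Φ := by
  refine ⟨Equivalence.ofData (Pushout.idLeft Φ.trans.σ) (Pushout.idLeft Φ.graph.left)
    (Equiv.emptySum Empty _) rfl rfl ?_ ?_ ?_ (fun _ => rfl) (fun _ => rfl) ?_ ?_⟩
  · intro A
    refine heq_of_eq ?_
    exact ((Category.id_comp _).trans (Category.id_comp _)).symm
  · rintro (t | t)
    · exact t.elim
    · refine Set.Subset.antisymm (fun q hq => ⟨_, ⟨q, hq, rfl⟩, rfl⟩) ?_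
      rintro _ ⟨_, ⟨q, hq, rfl⟩, rfl⟩
      exact hq
  · rintro (t | t)
    · exact t.elim
    · refine Set.Subset.antisymm (fun q hq => ⟨_, ⟨q, hq, rfl⟩, rfl⟩) ?_
      rintro _ ⟨_, ⟨q, hq, rfl⟩, rfl⟩
      exact hq
  · rintro (p | t | t)
    · induction p using Pushout.ind with
      | hl p => exact Φ.index_left p
      | hr p => rfl
    · exact t.elim
    · rfl
  · intro hac x
    rw [comp_disc_eq_true, ← hac]
    constructor
    · rintro ⟨_, _, h⟩
      exact h _ ((Pushout.idLeft Φ.trans.σ).symm_apply_apply x)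
    · intro h
      refine ⟨(hΦ.disc_spec _ h).1, fun _ _ => rfl, ?_⟩
      rintro z rfl
      exact h

theorem comp_id {Φ : Tuple X Y} (hΦ : Φ.IsValid) : Φ.comp (Tuple.id Y) ≈ Φ := by
  refine ⟨Equivalence.ofData (Pushout.idRight Φ.trans.τ) (Pushout.idRight Φ.graph.right)
    (Equiv.sumEmpty _ Empty) rfl rfl ?_ ?_ ?_ (fun _ => rfl) (fun _ => rfl) ?_ ?_⟩
  · intro A
    refine heq_of_eq ?_
    exact ((congrArg _ (Category.id_comp _)).trans (Category.comp_id _)).symm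
  · rintro (t | t)
    · refine Set.Subset.antisymm (fun q hq => ⟨_, ⟨q, hq, rfl⟩, rfl⟩) ?_
      rintro _ ⟨_, ⟨q, hq, rfl⟩, rfl⟩
      exact hq
    · exact t.elim
  · rintro (t | t)
    · refine Set.Subset.antisymm (fun q hq => ⟨_, ⟨q, hq, rfl⟩, rfl⟩) ?_
      rintro _ ⟨_, ⟨q, hq, rfl⟩, rfl⟩
      exact hq
    · exact t.elim
  · rintro (p | t | t)
    · induction p using Pushout.ind with
      | hl p => rfl
      | hr p => exact Φ.index_right p
    · rfl
    · exact t.elim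
  · intro hac x
    rw [comp_disc_eq_true, ← hac]
    constructor
    · rintro ⟨_, h, _⟩
      exact h _ ((Pushout.idRight Φ.trans.τ).symm_apply_apply x)
    · intro h
      refine ⟨(hΦ.disc_spec _ h).1, ?_, fun _ _ => rfl⟩
      rintro z rfl
      exact h

end Tuple

end

end GenFun

/-! ### Validity of identities and graphs of composites -/

namespace GenFun

section

variable {B : Type u₁} [Category.{v₁} B] {C : Type u₂} [Category.{v₂} C]

/-! ### Functoriality of the arguments -/

theorem Signed.mixMap_comp {X X' X'' Y Y' Y'' : B} (s : Variance) (g : X' ⟶ X) (h : Y ⟶ Y')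
    (g' : X'' ⟶ X') (h' : Y' ⟶ Y'') :
    Signed.mixMap s g h ≫ Signed.mixMap s g' h' = Signed.mixMap s (g' ≫ g) (h ≫ h') := by
  cases s <;> rfl

theorem argsMap_comp {α : List Variance} {V : Type} {A₁ A₁' A₁'' A₂ A₂' A₂'' : V → B}
    (g : ∀ v, A₁' v ⟶ A₁ v) (h : ∀ v, A₂ v ⟶ A₂' v) (g' : ∀ v, A₁'' v ⟶ A₁' v)
    (h' : ∀ v, A₂' v ⟶ A₂'' v) (σ : Fin α.length → V) :
    argsMap g h σ ≫ argsMap g' h' σ =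
      argsMap (fun v => g' v ≫ g v) (fun v => h v ≫ h' v) σ :=
  funext fun _ => Signed.mixMap_comp _ _ _ _ _

theorem NetCospan.IsGraph.mem_sources {α β : List Variance} {V : Type} {u : NetCospan α β V}
    (h : u.IsGraph) (p : u.net.P) : (∀ t, p ∉ u.net.out t) ↔
      (∃ j, α.get j = .plus ∧ u.left j = p) ∨ ∃ j, β.get j = .minus ∧ u.right j = p :=
  Set.ext_iff.1 h.sources_eq p

theorem NetCospan.IsGraph.mem_sinks {α β : List Variance} {V : Type} {u : NetCospan α β V}
    (h : u.IsGraph) (p : u.net.P) : (∀ t, p ∉ u.net.inp t) ↔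
      (∃ j, α.get j = .minus ∧ u.left j = p) ∨ ∃ j, β.get j = .plus ∧ u.right j = p :=
  Set.ext_iff.1 h.sinks_eq p

namespace Tuple

variable {X Y Z : Obj B C}

/-! ### Identity tuples -/

theorem id_not_arc (x y : (Tuple.id X).graph.net.Vertex) : ¬ (Tuple.id X).graph.net.Arc x y := by
  rintro (@⟨_, t, _⟩ | @⟨_, t, _⟩) <;> exact t.elim

theorem id_isValid (X : Obj B C) : (Tuple.id X).IsValid where
  isGraph := by
    have hconn : ∀ x y, (Tuple.id X).graph.net.Connected x y → x = y := by
      intro x y h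
      induction h with
      | rel _ _ h => exact (id_not_arc _ _ h).elim
      | refl => rfl
      | symm _ _ _ ih => exact ih.symm
      | trans _ _ _ _ _ ih ih' => exact ih.trans ih'
    refine ⟨⟨fun _ t => t.elim, fun _ t => t.elim⟩, fun t => t.elim, fun _ _ h => h,
      fun _ _ h => h, ?_, ?_, ?_, fun v => ⟨Sum.inl v, rfl⟩⟩
    · refine Set.ext fun p => ⟨fun _ => ?_, fun _ t => t.elim⟩
      cases h : X.arity.get p
      · exact .inl ⟨p, h, rfl⟩
      · exact .inr ⟨p, h, rfl⟩
    · refine Set.ext fun p => ⟨fun _ => ?_, fun _ t => t.elim⟩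
      cases h : X.arity.get p
      · exact .inr ⟨p, h, rfl⟩
      · exact .inl ⟨p, h, rfl⟩
    · rintro (x | t) (y | t')
      · exact ⟨fun h => congrArg Sum.inl h ▸ .refl _, fun h => Sum.inl_injective (hconn _ _ h)⟩
      · exact t'.elim
      · exact t.elim
      · exact t.elim
  disc_spec i _ := by
    refine ⟨fun x _ hx => ?_, fun A {P Q} f => ?_⟩
    · obtain ⟨y, h, -⟩ := Relation.TransGen.head'_iff.1 hx
      exact id_not_arc x y h
    -- Both sides collapse to the functor applied to `f` in all arguments of the variable at once.
    · simp only [Tuple.id, Category.id_comp, ← Functor.map_comp, argsMap_comp, Category.comp_id]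

/-! ### Graphs of composites -/

/-- A place that is an argument on both sides has the same sign on both sides. -/
def EndsCompatible (Φ : Tuple X Y) : Prop :=
  ∀ j k, Φ.graph.left j = Φ.graph.right k → X.arity.get j = Y.arity.get k

theorem EndsCompatible.of_equiv {Φ Φ' : Tuple X Y} (h : Φ ≈ Φ') (hΦ : Φ.EndsCompatible) :
    Φ'.EndsCompatible := by
  obtain ⟨e⟩ := h
  intro j k hjk
  rw [← e.left_eq, ← e.right_eq] at hjk
  exact hΦ j k (e.fP.injective hjk)

theorem standard_endsCompatible {V : Type} [Finite V] (φ : Transformation V X.functor Y.functor)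
    (Δ : V → Bool) : (standard φ Δ).EndsCompatible :=
  fun _ _ h => nomatch h

/-- A place shared by the outer ends lies on the interface, and the sign is passed on through its
middle argument. `IsGraph` alone does not give this property: a place with sign `+` on the left and
`-` on the right would count as a source twice. -/
theorem comp_endsCompatible {Φ : Tuple X Y} {Ψ : Tuple Y Z} (hl : Function.Injective Ψ.graph.left)
    (hΦ : Φ.EndsCompatible) (hΨ : Ψ.EndsCompatible) : (Φ.comp Ψ).EndsCompatible := by
  intro j k hjk
  obtain ⟨s, h1, h2⟩ := Pushout.exists_of_inl_eq_inr hl hjk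
  exact (hΦ j s h1.symm).trans (hΨ s k h2)

/-- The places of a glued net that are used by no transition, where `O` and `O'` are the inputs (or
the outputs) of the two nets, and `a`, `b` are the two signs. -/
theorem unused_glue {P P' T T' : Type} {α β γ : List Variance} {O : T → Set P} {O' : T' → Set P'}
    {left : Fin α.length → P} {right : Fin β.length → P} {left' : Fin β.length → P'}
    {right' : Fin γ.length → P'} {a b : Variance} (hab : a ≠ b) (hs : ∀ s, s = a ∨ s = b)
    (hr : Function.Injective right) (hl : Function.Injective left')
    (hc : ∀ j k, left j = right k → α.get j = β.get k)
    (hc' : ∀ j k, left' j = right' k → β.get j = γ.get k)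
    (h : ∀ p, (∀ t, p ∉ O t) ↔
      (∃ j, α.get j = a ∧ left j = p) ∨ ∃ j, β.get j = b ∧ right j = p)
    (h' : ∀ p, (∀ t, p ∉ O' t) ↔
      (∃ j, β.get j = a ∧ left' j = p) ∨ ∃ j, γ.get j = b ∧ right' j = p)
    (p : Pushout right left') :
    (∀ t, p ∉ Sum.elim (fun t => Pushout.inl '' O t) (fun t => Pushout.inr '' O' t) t) ↔
      (∃ j, α.get j = a ∧ Pushout.inl (left j) = p) ∨
        ∃ j, γ.get j = b ∧ Pushout.inr (right' j) = p := by
  have il := Pushout.inl_injective (f := right) hl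
  have ir := Pushout.inr_injective (g := left') hr
  constructor
  · intro hp
    have hN : ∀ q, p = Pushout.inl q → ∀ t, q ∉ O t :=
      fun q hq t ht => hp (Sum.inl t) ⟨q, ht, hq.symm⟩
    have hN' : ∀ q, p = Pushout.inr q → ∀ t, q ∉ O' t :=
      fun q hq t ht => hp (Sum.inr t) ⟨q, ht, hq.symm⟩
    -- An unused interface place is traced to an outer end: with sign `a` the first net must account
    -- for it, with sign `b` the second. The opposite alternative would give one argument both
    -- signs.
    have key : ∀ j, p = Pushout.inl (right j) → (∃ j, α.get j = a ∧ Pushout.inl (left j) = p) ∨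
        ∃ j, γ.get j = b ∧ Pushout.inr (right' j) = p := by
      intro j hj
      have hj' := hj.trans (Pushout.condition j)
      rcases hs (β.get j) with hb | hb
      · rcases (h _).1 (hN _ hj) with ⟨k, hk, hkj⟩ | ⟨k, hk, hkj⟩
        · exact .inl ⟨k, hk, by rw [hkj, hj]⟩
        · rw [hr hkj, hb] at hk
          exact (hab hk).elim
      · rcases (h' _).1 (hN' _ hj') with ⟨k, hk, hkj⟩ | ⟨k, hk, hkj⟩
        · rw [hl hkj, hb] at hk
          exact (hab hk.symm).elim
        · exact .inr ⟨k, hk, by rw [hkj, hj']⟩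
    rcases Pushout.exists_inl_or_inr p with ⟨q, hq⟩ | ⟨q, hq⟩
    · rcases (h q).1 (hN q hq) with ⟨j, hj, rfl⟩ | ⟨j, _, rfl⟩
      · exact .inl ⟨j, hj, hq.symm⟩
      · exact key j hq
    · rcases (h' q).1 (hN' q hq) with ⟨j, _, rfl⟩ | ⟨j, hj, rfl⟩
      · exact key j (hq.trans (Pushout.condition j).symm)
      · exact .inr ⟨j, hj, hq.symm⟩
  -- In the two mixed cases an outer argument is also an interface place, and compatibility of the
  -- ends carries its sign across.
  · rintro (⟨j, hj, rfl⟩ | ⟨j, hj, rfl⟩) (t | t) ⟨q, hq, hqe⟩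
    · rw [il hqe] at hq
      exact (h _).2 (.inl ⟨j, hj, rfl⟩) t hq
    · obtain ⟨s, h1, rfl⟩ := Pushout.exists_of_inl_eq_inr hl hqe.symm
      exact (h' _).2 (.inl ⟨s, (hc j s h1.symm).symm.trans hj, rfl⟩) t hq
    · obtain ⟨s, rfl, h2⟩ := Pushout.exists_of_inl_eq_inr hl hqe
      exact (h _).2 (.inr ⟨s, (hc' s j h2).trans hj, rfl⟩) t hq
    · rw [ir hqe] at hq
      exact (h' _).2 (.inr ⟨j, hj, rfl⟩) t hq

theorem comp_index_inl (Φ : Tuple X Y) (Ψ : Tuple Y Z) (x : Φ.graph.net.Vertex) :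
    (Φ.comp Ψ).graph.index (Sum.map Pushout.inl Sum.inl x) = Pushout.inl (Φ.graph.index x) := by
  cases x <;> rfl

theorem comp_index_inr (Φ : Tuple X Y) (Ψ : Tuple Y Z) (x : Ψ.graph.net.Vertex) :
    (Φ.comp Ψ).graph.index (Sum.map Pushout.inr Sum.inr x) = Pushout.inr (Ψ.graph.index x) := by
  cases x <;> rfl

theorem comp_vertex_cases (Φ : Tuple X Y) (Ψ : Tuple Y Z) (x : (Φ.comp Ψ).graph.net.Vertex) :
    (∃ y : Φ.graph.net.Vertex, x = Sum.map Pushout.inl Sum.inl y) ∨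
      ∃ y : Ψ.graph.net.Vertex, x = Sum.map Pushout.inr Sum.inr y := by
  rcases x with p | t | t
  · rcases Pushout.exists_inl_or_inr p with ⟨q, rfl⟩ | ⟨q, rfl⟩
    · exact .inl ⟨Sum.inl q, rfl⟩
    · exact .inr ⟨Sum.inl q, rfl⟩
  · exact .inl ⟨Sum.inr t, rfl⟩
  · exact .inr ⟨Sum.inr t, rfl⟩

theorem comp_index_eq_of_connected {Φ : Tuple X Y} {Ψ : Tuple Y Z} (hΦ : Φ.graph.IsGraph)
    (hΨ : Ψ.graph.IsGraph) {x y : (Φ.comp Ψ).graph.net.Vertex}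
    (h : (Φ.comp Ψ).graph.net.Connected x y) :
    (Φ.comp Ψ).graph.index x = (Φ.comp Ψ).graph.index y := by
  induction h with
  | rel _ _ h =>
    rcases h with @⟨_, t | t, q, hq, rfl⟩ | @⟨_, t | t, q, hq, rfl⟩
    · exact congrArg Pushout.inl ((hΦ.index_eq_iff (Sum.inl q) (Sum.inr t)).2 (.rel _ _ (.inp hq)))
    · exact congrArg Pushout.inr ((hΨ.index_eq_iff (Sum.inl q) (Sum.inr t)).2 (.rel _ _ (.inp hq)))
    · exact congrArg Pushout.inl ((hΦ.index_eq_iff (Sum.inr t) (Sum.inl q)).2 (.rel _ _ (.out hq)))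
    · exact congrArg Pushout.inr ((hΨ.index_eq_iff (Sum.inr t) (Sum.inl q)).2 (.rel _ _ (.out hq)))
  | refl => rfl
  | symm _ _ _ ih => exact ih.symm
  | trans _ _ _ _ _ ih ih' => exact ih.trans ih'

/-- Choosing a vertex in each component of the two nets defines a map from the pushout of indices to
the components of the glued net. It is well defined on the interface because glued places coincide,
and it recovers the component of a vertex from its index. -/
theorem comp_connected_of_index_eq {Φ : Tuple X Y} {Ψ : Tuple Y Z} (hΦ : Φ.graph.IsGraph)
    (hΨ : Ψ.graph.IsGraph) {x y : (Φ.comp Ψ).graph.net.Vertex}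
    (h : (Φ.comp Ψ).graph.index x = (Φ.comp Ψ).graph.index y) :
    (Φ.comp Ψ).graph.net.Connected x y := by
  choose c hc using hΦ.index_surjective
  choose c' hc' using hΨ.index_surjective
  let q : (Φ.comp Ψ).graph.net.Vertex → Quot (Φ.comp Ψ).graph.net.Arc := Quot.mk _
  have hq : ∀ y, q (Sum.map Pushout.inl Sum.inl (c (Φ.graph.index y))) =
      q (Sum.map Pushout.inl Sum.inl y) := fun y =>
    Quot.eqvGen_sound (PetriNet.connected_glue_inl ((hΦ.index_eq_iff _ _).1 (hc _)))
  have hq' : ∀ y, q (Sum.map Pushout.inr Sum.inr (c' (Ψ.graph.index y))) =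
      q (Sum.map Pushout.inr Sum.inr y) := fun y =>
    Quot.eqvGen_sound (PetriNet.connected_glue_inr ((hΨ.index_eq_iff _ _).1 (hc' _)))
  let d : (Φ.comp Ψ).V → Quot (Φ.comp Ψ).graph.net.Arc :=
    Pushout.desc (fun v => q (Sum.map Pushout.inl Sum.inl (c v)))
      (fun v => q (Sum.map Pushout.inr Sum.inr (c' v))) (fun s => by
        rw [← Φ.index_right, ← Ψ.index_left, hq, hq']
        exact congrArg (fun p => q (Sum.inl p)) (Pushout.condition s))
  have hd : ∀ x, d ((Φ.comp Ψ).graph.index x) = q x := by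
    intro x
    rcases comp_vertex_cases Φ Ψ x with ⟨y, rfl⟩ | ⟨y, rfl⟩
    · exact (congrArg d (comp_index_inl Φ Ψ y)).trans (hq y)
    · exact (congrArg d (comp_index_inr Φ Ψ y)).trans (hq' y)
  exact Quot.eqvGen_exact ((hd x).symm.trans ((congrArg d h).trans (hd y)))

theorem comp_isGraph {Φ : Tuple X Y} {Ψ : Tuple Y Z} (hΦ : Φ.graph.IsGraph)
    (hΨ : Ψ.graph.IsGraph) (eΦ : Φ.EndsCompatible) (eΨ : Ψ.EndsCompatible) :
    (Φ.comp Ψ).graph.IsGraph := by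
  have il := Pushout.inl_injective (f := Φ.graph.right) hΨ.left_injective
  have ir := Pushout.inr_injective (g := Ψ.graph.left) hΦ.right_injective
  -- An interface place is a sink of the first net if its sign is `+` and of the second if it is
  -- `-`, so it is never consumed on both sides. The next claim is the dual one, with sources.
  have hi : ∀ q q' t t', q ∈ Φ.graph.net.inp t → q' ∈ Ψ.graph.net.inp t' →
      (Pushout.inl q : Pushout Φ.graph.right Ψ.graph.left) ≠ Pushout.inr q' := by
    intro q q' t t' hq hq' h
    obtain ⟨s, rfl, rfl⟩ := Pushout.exists_of_inl_eq_inr hΨ.left_injective h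
    cases hs : Y.arity.get s
    · exact (hΦ.mem_sinks _).2 (.inr ⟨s, hs, rfl⟩) t hq
    · exact (hΨ.mem_sinks _).2 (.inl ⟨s, hs, rfl⟩) t' hq'
  have ho : ∀ q q' t t', q ∈ Φ.graph.net.out t → q' ∈ Ψ.graph.net.out t' →
      (Pushout.inl q : Pushout Φ.graph.right Ψ.graph.left) ≠ Pushout.inr q' := by
    intro q q' t t' hq hq' h
    obtain ⟨s, rfl, rfl⟩ := Pushout.exists_of_inl_eq_inr hΨ.left_injective h
    cases hs : Y.arity.get s
    · exact (hΨ.mem_sources _).2 (.inl ⟨s, hs, rfl⟩) t' hq'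
    · exact (hΦ.mem_sources _).2 (.inr ⟨s, hs, rfl⟩) t hq
  refine ⟨⟨?_, ?_⟩, ?_, ?_, ?_, ?_, ?_, ?_, ?_⟩
  · rintro p (t | t) (t' | t') ⟨q, hq, rfl⟩ ⟨q', hq', h⟩
    · rw [il h] at hq'
      exact congrArg Sum.inl (hΦ.fbcf.1 _ _ _ hq hq')
    · exact (hi _ _ _ _ hq hq' h.symm).elim
    · exact (hi _ _ _ _ hq' hq h).elim
    · rw [ir h] at hq'
      exact congrArg Sum.inr (hΨ.fbcf.1 _ _ _ hq hq')
  · rintro p (t | t) (t' | t') ⟨q, hq, rfl⟩ ⟨q', hq', h⟩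
    · rw [il h] at hq'
      exact congrArg Sum.inl (hΦ.fbcf.2 _ _ _ hq hq')
    · exact (ho _ _ _ _ hq hq' h.symm).elim
    · exact (ho _ _ _ _ hq' hq h).elim
    · rw [ir h] at hq'
      exact congrArg Sum.inr (hΨ.fbcf.2 _ _ _ hq hq')
  · rintro (t | t) p ⟨⟨q, hq, rfl⟩, ⟨q', hq', h⟩⟩
    · rw [il h] at hq'
      exact hΦ.noSelfLoop _ _ ⟨hq, hq'⟩
    · rw [ir h] at hq'
      exact hΨ.noSelfLoop _ _ ⟨hq, hq'⟩
  · exact fun j k h => hΦ.left_injective (il h)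
  · exact fun j k h => hΨ.right_injective (ir h)
  · exact Set.ext fun p => unused_glue (a := .plus) (b := .minus) (by simp)
      (fun s => by cases s <;> simp) hΦ.right_injective hΨ.left_injective eΦ eΨ
      hΦ.mem_sources hΨ.mem_sources p
  · exact Set.ext fun p => unused_glue (a := .minus) (b := .plus) (by simp)
      (fun s => by cases s <;> simp) hΦ.right_injective hΨ.left_injective eΦ eΨ
      hΦ.mem_sinks hΨ.mem_sinks p
  · exact fun x y => ⟨comp_connected_of_index_eq hΦ hΨ, comp_index_eq_of_connected hΦ hΨ⟩
  · intro v
    induction v using Pushout.ind with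
    | hl v =>
      obtain ⟨x, rfl⟩ := hΦ.index_surjective v
      exact ⟨_, comp_index_inl Φ Ψ x⟩
    | hr v =>
      obtain ⟨x, rfl⟩ := hΨ.index_surjective v
      exact ⟨_, comp_index_inr Φ Ψ x⟩

end Tuple

end

end GenFun

/-! ### Stages, hexagons in diagrams on a preorder, and refinements -/

namespace GenFun

/-! ### Stages -/

/-- A variable together with a bit, which tells whether the transitions of interest have been
fired. -/
structure Stage (V : Type) where
  var : V
  fired : Bool

namespace Stage

/-- Fired lies below unfired because firing replaces the target of an arrow by its source. -/
instance (V : Type) : Preorder (Stage V) where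
  le x y := x.var = y.var ∧ (y.fired = true → x.fired = true)
  le_refl _ := ⟨rfl, fun h => h⟩
  le_trans _ _ _ h h' := ⟨h.1.trans h'.1, fun hz => h.2 (h'.2 hz)⟩

/-- Functoriality of `Stage`. -/
def mapFunctor {V V' : Type} (u : V → V') : Stage V ⥤ Stage V' :=
  Monotone.functor (f := fun x => ⟨u x.var, x.fired⟩) fun _ _ h => ⟨congrArg u h.1, h.2⟩

variable {B : Type u₁} [Category.{v₁} B]

/-- A family of arrows, as a functor: fired variables are sent to the source, the others to the
target. -/
def ofArrows {V : Type} {P Q : V → B} (h : ∀ v, P v ⟶ Q v) : Stage V ⥤ B where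
  obj
    | ⟨v, true⟩ => P v
    | ⟨v, false⟩ => Q v
  map {x y} f := match x, y, leOfHom f with
    | ⟨v, true⟩, ⟨_, true⟩, hf => eqToHom (congrArg P hf.1)
    | ⟨v, true⟩, ⟨_, false⟩, hf => h v ≫ eqToHom (congrArg Q hf.1)
    | ⟨v, false⟩, ⟨_, false⟩, hf => eqToHom (congrArg Q hf.1)
    | ⟨v, false⟩, ⟨_, true⟩, hf => absurd (hf.2 rfl) Bool.false_ne_true
  map_id := by
    rintro ⟨v, (_ | _)⟩ <;> rfl
  map_comp := by
    rintro ⟨x, (_ | _)⟩ ⟨y, (_ | _)⟩ ⟨z, (_ | _)⟩ f g <;>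
    first
      | exact absurd ((leOfHom f).2 rfl) Bool.false_ne_true
      | exact absurd ((leOfHom g).2 rfl) Bool.false_ne_true
      | (obtain rfl : x = y := (leOfHom f).1
         obtain rfl : x = z := (leOfHom g).1
         simp)

end Stage

/-! ### Arguments in a preorder -/

/-- The relation between `(a, b)` and `(a', b')` which is `a' ≤ a` for the sign `-` and `b ≤ b'` for
the sign `+`. -/
def Signed.MixLE {K : Type} [Preorder K] : Variance → K → K → K → K → Prop
  | .plus, _, b, _, b' => b ≤ b'
  | .minus, a, _, a', _ => a' ≤ a

/-- `Signed.MixLE` for all arguments. -/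
def ArgsLE {K : Type} [Preorder K] {α : List Variance} (a b a' b' : Fin α.length → K) : Prop :=
  ∀ j, Signed.MixLE (α.get j) (a j) (b j) (a' j) (b' j)

namespace ArgsLE

variable {K : Type} [Preorder K] {α : List Variance} {a b a' b' a'' b'' c d c' d' : Fin α.length → K}

theorem intro (h : ∀ j, α.get j = .minus → a' j ≤ a j) (h' : ∀ j, α.get j = .plus → b j ≤ b' j) :
    ArgsLE (α := α) a b a' b' := by
  intro j
  cases hj : α.get j
  · exact h' j hj
  · exact h j hj

theorem minus (h : ArgsLE (α := α) a b a' b') {j : Fin α.length} (hj : α.get j = .minus) :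
    a' j ≤ a j := by
  have := h j
  rwa [hj] at this

theorem plus (h : ArgsLE (α := α) a b a' b') {j : Fin α.length} (hj : α.get j = .plus) :
    b j ≤ b' j := by
  have := h j
  rwa [hj] at this

theorem trans (h : ArgsLE (α := α) a b a' b') (h' : ArgsLE (α := α) a' b' a'' b'') :
    ArgsLE (α := α) a b a'' b'' :=
  intro (fun _ hj => (h'.minus hj).trans (h.minus hj)) fun _ hj => (h.plus hj).trans (h'.plus hj)

theorem of_le (h : ∀ j, a' j ≤ a j) (h' : ∀ j, b j ≤ b' j) : ArgsLE (α := α) a b a' b' :=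
  intro (fun j _ => h j) fun j _ => h' j

/-- The contravariant part of one inequality and the covariant part of another one. -/
theorem combine (h : ArgsLE (α := α) a c a' d) (h' : ArgsLE (α := α) c' b d' b') :
    ArgsLE (α := α) a b a' b' :=
  intro (fun _ hj => h.minus hj) fun _ hj => h'.plus hj

end ArgsLE

section

variable {B : Type u₁} [Category.{v₁} B] {C : Type u₂} [Category.{v₂} C] {K : Type} [Preorder K]

/-- The morphism induced by `Signed.MixLE`. -/
def Signed.mixHom (D : K ⥤ B) : ∀ (s : Variance) {a b a' b' : K}, Signed.MixLE s a b a' b' →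
    (Signed.mix s (D.obj a) (D.obj b) ⟶ Signed.mix s (D.obj a') (D.obj b'))
  | .plus, _, _, _, _, h => (D.map (homOfLE h) : (_ : B) ⟶ _)
  | .minus, _, _, _, _, h => ((D.map (homOfLE h)).op : (_ : Bᵒᵖ) ⟶ _)

/-- The arguments given by a diagram `D`. -/
def diagArgs (D : K ⥤ B) {α : List Variance} (a b : Fin α.length → K) : MixedPow B α :=
  fun j => Signed.mix (α.get j) (D.obj (a j)) (D.obj (b j))

/-- The morphism induced by `ArgsLE`. -/
def diagHom (D : K ⥤ B) {α : List Variance} {a b a' b' : Fin α.length → K}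
    (h : ArgsLE (α := α) a b a' b') : (diagArgs D a b : MixedPow B α) ⟶ diagArgs D a' b' :=
  fun j => Signed.mixHom D (α.get j) (h j)

theorem Signed.mixHom_comp (D : K ⥤ B) (s : Variance) {a b a' b' a'' b'' : K}
    (h : Signed.MixLE s a b a' b') (h' : Signed.MixLE s a' b' a'' b'')
    (h'' : Signed.MixLE s a b a'' b'') :
    Signed.mixHom D s h ≫ Signed.mixHom D s h' = Signed.mixHom D s h'' := by
  cases s
  · exact (D.map_comp (homOfLE h) (homOfLE h')).symm
  · exact congrArg Quiver.Hom.op (D.map_comp (homOfLE h') (homOfLE h)).symm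

theorem Signed.mixHom_refl (D : K ⥤ B) (s : Variance) {a b : K} (h : Signed.MixLE s a b a b) :
    Signed.mixHom D s h = 𝟙 _ := by
  cases s
  · exact D.map_id _
  · exact congrArg Quiver.Hom.op (D.map_id _)

section

variable (D : K ⥤ B) {α : List Variance} (F : MixedPow B α ⥤ C)
  {a b a' b' a'' b'' : Fin α.length → K}

/-- The proof of `ArgsLE` is irrelevant, so any two chains of comparisons with the same ends have
the same composite. Most later diagram chases reduce to this. -/
theorem map_diagHom_comp (h : ArgsLE (α := α) a b a' b') (h' : ArgsLE (α := α) a' b' a'' b'') :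
    F.map (diagHom D h) ≫ F.map (diagHom D h') = F.map (diagHom D (h.trans h')) := by
  rw [← F.map_comp]
  exact congrArg F.map (funext fun j => Signed.mixHom_comp D _ (h j) (h' j) _)

theorem map_diagHom_comp_assoc (h : ArgsLE (α := α) a b a' b')
    (h' : ArgsLE (α := α) a' b' a'' b'') {Z : C} (k : F.obj (diagArgs D a'' b'') ⟶ Z) :
    F.map (diagHom D h) ≫ F.map (diagHom D h') ≫ k = F.map (diagHom D (h.trans h')) ≫ k := by
  rw [← Category.assoc, map_diagHom_comp]

theorem map_diagHom_refl (h : ArgsLE (α := α) a b a b) : F.map (diagHom D h) = 𝟙 _ := by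
  rw [← F.map_id]
  exact congrArg F.map (funext fun j => Signed.mixHom_refl D _ (h j))

theorem eqToHom_eq_map_diagHom (ha : a = a') (hb : b = b')
    (h : F.obj (diagArgs D a b) = F.obj (diagArgs D a' b')) (h' : ArgsLE (α := α) a b a' b') :
    eqToHom h = F.map (diagHom D h') := by
  subst ha hb
  rw [map_diagHom_refl]
  rfl

theorem argsMap_left_eq_diagHom {V : Type} {x y : V → K} (hxy : ∀ v, x v ≤ y v)
    (σ : Fin α.length → V)
    (h : ArgsLE (α := α) (fun j => y (σ j)) (fun j => x (σ j)) (fun j => x (σ j))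
      (fun j => x (σ j))) :
    argsMap (α := α) (fun v => D.map (homOfLE (hxy v))) (fun v => 𝟙 (D.obj (x v))) σ =
      diagHom D h := by
  funext j
  change Signed.mixMap _ _ _ = Signed.mixHom D _ (h j)
  generalize h j = hj
  revert hj
  cases α.get j <;> intro hj
  · exact (D.map_id _).symm
  · rfl

theorem argsMap_left_eq_diagHom' {V : Type} {x y : V → K} (hxy : ∀ v, x v ≤ y v)
    (σ : Fin α.length → V)
    (h : ArgsLE (α := α) (fun j => y (σ j)) (fun j => y (σ j)) (fun j => x (σ j))
      (fun j => y (σ j))) :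
    argsMap (α := α) (fun v => D.map (homOfLE (hxy v))) (fun v => 𝟙 (D.obj (y v))) σ =
      diagHom D h := by
  funext j
  change Signed.mixMap _ _ _ = Signed.mixHom D _ (h j)
  generalize h j = hj
  revert hj
  cases α.get j <;> intro hj
  · exact (D.map_id _).symm
  · rfl

theorem argsMap_right_eq_diagHom {V : Type} {x y : V → K} (hxy : ∀ v, x v ≤ y v)
    (σ : Fin α.length → V)
    (h : ArgsLE (α := α) (fun j => y (σ j)) (fun j => x (σ j)) (fun j => y (σ j))
      (fun j => y (σ j))) :
    argsMap (α := α) (fun v => 𝟙 (D.obj (y v))) (fun v => D.map (homOfLE (hxy v))) σ =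
      diagHom D h := by
  funext j
  change Signed.mixMap _ _ _ = Signed.mixHom D _ (h j)
  generalize h j = hj
  revert hj
  cases α.get j <;> intro hj
  · rfl
  · exact congrArg Quiver.Hom.op (D.map_id _).symm

theorem argsMap_right_eq_diagHom' {V : Type} {x y : V → K} (hxy : ∀ v, x v ≤ y v)
    (σ : Fin α.length → V)
    (h : ArgsLE (α := α) (fun j => x (σ j)) (fun j => x (σ j)) (fun j => x (σ j))
      (fun j => y (σ j))) :
    argsMap (α := α) (fun v => 𝟙 (D.obj (x v))) (fun v => D.map (homOfLE (hxy v))) σ =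
      diagHom D h := by
  funext j
  change Signed.mixMap _ _ _ = Signed.mixHom D _ (h j)
  generalize h j = hj
  revert hj
  cases α.get j <;> intro hj
  · rfl
  · exact congrArg Quiver.Hom.op (D.map_id _).symm

end

/-- The hexagon for two families `x ≤ y` of points of a diagram, indexed by the arguments. -/
def DiagHexagon (D : K ⥤ B) {α β : List Variance} (F : MixedPow B α ⥤ C) (G : MixedPow B β ⥤ C)
    {x y : Fin α.length → K} {x' y' : Fin β.length → K}
    (ex : F.obj (diagArgs D x x) ⟶ G.obj (diagArgs D x' x'))
    (ey : F.obj (diagArgs D y y) ⟶ G.obj (diagArgs D y' y')) : Prop :=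
  ∀ (h₁ : ArgsLE (α := α) y x x x) (h₂ : ArgsLE (α := β) x' x' x' y')
    (h₃ : ArgsLE (α := α) y x y y) (h₄ : ArgsLE (α := β) y' y' x' y'),
    F.map (diagHom D h₁) ≫ ex ≫ G.map (diagHom D h₂) =
      F.map (diagHom D h₃) ≫ ey ≫ G.map (diagHom D h₄)

theorem comp_congr_outer {a b c d : C} {f f' : a ⟶ b} (g : b ⟶ c) {h h' : c ⟶ d} (hf : f = f')
    (hh : h = h') : f ≫ g ≫ h = f' ≫ g ≫ h' := by
  rw [hf, hh]

theorem map_homOfLE_eq_eqToHom (D : K ⥤ B) {x y : K} (h : x ≤ y) (e : x = y) :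
    D.map (homOfLE h) = eqToHom (congrArg D.obj e) := by
  subst e
  exact D.map_id x

/-- When the arrows come from a diagram, all four outer maps of the hexagon are comparison maps. The
inequalities quantified over in `DiagHexagon` follow from `x ≤ y`. -/
theorem Transformation.hexagon_iff_diagHexagon {α β : List Variance} {V : Type}
    {F : MixedPow B α ⥤ C} {G : MixedPow B β ⥤ C} (φ : Transformation V F G) (D : K ⥤ B)
    {x y : V → K} (hxy : ∀ v, x v ≤ y v) :
    φ.Hexagon (fun v => D.map (homOfLE (hxy v))) ↔
      DiagHexagon D F G (x := fun j => x (φ.σ j)) (y := fun j => y (φ.σ j))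
        (x' := fun j => x (φ.τ j)) (y' := fun j => y (φ.τ j))
        (φ.app fun v => D.obj (x v)) (φ.app fun v => D.obj (y v)) := by
  have h₁ : ArgsLE (α := α) (fun j => y (φ.σ j)) (fun j => x (φ.σ j)) (fun j => x (φ.σ j))
    (fun j => x (φ.σ j)) := .of_le (fun _ => hxy _) (fun _ => le_rfl)
  have h₂ : ArgsLE (α := β) (fun j => x (φ.τ j)) (fun j => x (φ.τ j)) (fun j => x (φ.τ j))
    (fun j => y (φ.τ j)) := .of_le (fun _ => le_rfl) (fun _ => hxy _)
  have h₃ : ArgsLE (α := α) (fun j => y (φ.σ j)) (fun j => x (φ.σ j)) (fun j => y (φ.σ j))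
    (fun j => y (φ.σ j)) := .of_le (fun _ => le_rfl) (fun _ => hxy _)
  have h₄ : ArgsLE (α := β) (fun j => y (φ.τ j)) (fun j => y (φ.τ j)) (fun j => x (φ.τ j))
    (fun j => y (φ.τ j)) := .of_le (fun _ => hxy _) (fun _ => le_rfl)
  have e := comp_congr_outer (φ.app fun v => D.obj (x v))
    (congrArg F.map (argsMap_left_eq_diagHom D hxy φ.σ h₁))
    (congrArg G.map (argsMap_right_eq_diagHom' D hxy φ.τ h₂))
  have e' := comp_congr_outer (φ.app fun v => D.obj (y v))
    (congrArg F.map (argsMap_right_eq_diagHom D hxy φ.σ h₃))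
    (congrArg G.map (argsMap_left_eq_diagHom' D hxy φ.τ h₄))
  exact ⟨fun H _ _ _ _ => e.symm.trans (H.trans e'),
    fun H => e.trans ((H h₁ h₂ h₃ h₄).trans e'.symm)⟩

theorem DiagHexagon.refl (D : K ⥤ B) {α β : List Variance} {F : MixedPow B α ⥤ C}
    {G : MixedPow B β ⥤ C} {x : Fin α.length → K} {x' : Fin β.length → K}
    (e : F.obj (diagArgs D x x) ⟶ G.obj (diagArgs D x' x')) : DiagHexagon D F G e e :=
  fun _ _ _ _ => rfl

/-- Pre- and postcomposing both hexagons so that they run from `F` at `(z, x)` to `G` at `(x', z')`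
makes them share the path through `ey`. -/
theorem DiagHexagon.trans {D : K ⥤ B} {α β : List Variance} {F : MixedPow B α ⥤ C}
    {G : MixedPow B β ⥤ C} {x y z : Fin α.length → K} {x' y' z' : Fin β.length → K}
    {ex : F.obj (diagArgs D x x) ⟶ G.obj (diagArgs D x' x')}
    {ey : F.obj (diagArgs D y y) ⟶ G.obj (diagArgs D y' y')}
    {ez : F.obj (diagArgs D z z) ⟶ G.obj (diagArgs D z' z')}
    (hxy : ∀ j, x j ≤ y j) (hyz : ∀ j, y j ≤ z j) (hxy' : ∀ j, x' j ≤ y' j)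
    (hyz' : ∀ j, y' j ≤ z' j) (H : DiagHexagon D F G ex ey) (H' : DiagHexagon D F G ey ez) :
    DiagHexagon D F G ex ez := by
  intro h₁ h₂ h₃ h₄
  have r : ∀ j, x j ≤ x j := fun _ => le_rfl
  have ry : ∀ j, y j ≤ y j := fun _ => le_rfl
  have rz : ∀ j, z j ≤ z j := fun _ => le_rfl
  have r' : ∀ j, x' j ≤ x' j := fun _ => le_rfl
  have ry' : ∀ j, y' j ≤ y' j := fun _ => le_rfl
  have rz' : ∀ j, z' j ≤ z' j := fun _ => le_rfl
  have E := H (.of_le hxy r) (.of_le r' hxy') (.of_le ry hxy) (.of_le hxy' ry')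
  have E' := H' (.of_le hyz ry) (.of_le ry' hyz') (.of_le rz hyz) (.of_le hyz' rz')
  have E₁ := congrArg (fun k => F.map (diagHom D (.of_le hyz r : ArgsLE (α := α) z x y x)) ≫ k ≫
    G.map (diagHom D (.of_le r' hyz' : ArgsLE (α := β) x' y' x' z'))) E
  have E₂ := congrArg (fun k => F.map (diagHom D (.of_le rz hxy : ArgsLE (α := α) z x z y)) ≫ k ≫
    G.map (diagHom D (.of_le hxy' rz' : ArgsLE (α := β) y' z' x' z'))) E'
  simp only [Category.assoc, map_diagHom_comp, map_diagHom_comp_assoc] at E₁ E₂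
  exact E₁.trans E₂

namespace Tuple

variable {X Y Z : Obj B C}

/-! ### Refinements -/

/-- The stage of the variable of a transition, given the set of transitions that have been fired. -/
def stage (Φ : Tuple X Y) (s : Φ.graph.net.T → Bool) (t : Φ.graph.net.T) : Stage Φ.V :=
  ⟨Φ.graph.index (Sum.inr t), s t⟩

/-- A set of transitions is closed if it contains all causes of its elements. -/
def Closed (Φ : Tuple X Y) (s : Φ.graph.net.T → Bool) : Prop :=
  ∀ p t t', p ∈ Φ.graph.net.out t → p ∈ Φ.graph.net.inp t' → s t' = true → s t = true

/-- A refinement of a tuple: every argument is attached to exactly one transition, and the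
transformation extends to a family of morphisms in which the variables of different transitions are
independent, as long as the set of fired transitions is closed. Firing one further transition, with a
variable of discriminant `1`, amounts to a hexagon. -/
structure Refinement (Φ : Tuple X Y) where
  l : Fin X.arity.length → Φ.graph.net.T
  r : Fin Y.arity.length → Φ.graph.net.T
  l_plus : ∀ j, X.arity.get j = .plus → Φ.graph.left j ∈ Φ.graph.net.inp (l j)
  l_minus : ∀ j, X.arity.get j = .minus → Φ.graph.left j ∈ Φ.graph.net.out (l j)
  r_plus : ∀ j, Y.arity.get j = .plus → Φ.graph.right j ∈ Φ.graph.net.out (r j)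
  r_minus : ∀ j, Y.arity.get j = .minus → Φ.graph.right j ∈ Φ.graph.net.inp (r j)
  index_l : ∀ j, Φ.graph.index (Sum.inr (l j)) = Φ.trans.σ j
  index_r : ∀ j, Φ.graph.index (Sum.inr (r j)) = Φ.trans.τ j
  app : ∀ (D : Stage Φ.V ⥤ B) (s : Φ.graph.net.T → Bool), Φ.Closed s →
    (X.functor.obj (diagArgs D (fun j => Φ.stage s (l j)) (fun j => Φ.stage s (l j))) ⟶
      Y.functor.obj (diagArgs D (fun j => Φ.stage s (r j)) (fun j => Φ.stage s (r j))))
  app_const : ∀ (D : Stage Φ.V ⥤ B) (c : Φ.V → Bool)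
    (hc : Φ.Closed fun t => c (Φ.graph.index (Sum.inr t)))
    (h₁ : ArgsLE (α := X.arity)
      (fun j => Φ.stage (fun t => c (Φ.graph.index (Sum.inr t))) (l j))
      (fun j => Φ.stage (fun t => c (Φ.graph.index (Sum.inr t))) (l j))
      (fun j => ⟨Φ.trans.σ j, c (Φ.trans.σ j)⟩) (fun j => ⟨Φ.trans.σ j, c (Φ.trans.σ j)⟩))
    (h₂ : ArgsLE (α := Y.arity)
      (fun j => ⟨Φ.trans.τ j, c (Φ.trans.τ j)⟩) (fun j => ⟨Φ.trans.τ j, c (Φ.trans.τ j)⟩)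
      (fun j => Φ.stage (fun t => c (Φ.graph.index (Sum.inr t))) (r j))
      (fun j => Φ.stage (fun t => c (Φ.graph.index (Sum.inr t))) (r j))),
    app D _ hc = X.functor.map (diagHom D h₁) ≫ Φ.trans.app (fun v => D.obj ⟨v, c v⟩) ≫
      Y.functor.map (diagHom D h₂)
  hexagon : ∀ (D : Stage Φ.V ⥤ B) (s s' : Φ.graph.net.T → Bool) (hs : Φ.Closed s)
    (hs' : Φ.Closed s') (t : Φ.graph.net.T), s' t = true → (∀ t', t' ≠ t → s' t' = s t') →
    Φ.disc (Φ.graph.index (Sum.inr t)) = true →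
    DiagHexagon D X.functor Y.functor (app D s' hs') (app D s hs)

theorem stage_le (Φ : Tuple X Y) {s s' : Φ.graph.net.T → Bool}
    (h : ∀ t, s t = true → s' t = true) (t : Φ.graph.net.T) : Φ.stage s' t ≤ Φ.stage s t :=
  ⟨rfl, h t⟩

/-- The refinement of a tuple with a standard graph. -/
def standardRefinement {V : Type} [Finite V] {φ : Transformation V X.functor Y.functor}
    {Δ : V → Bool} (h : (standard φ Δ).IsValid) : Refinement (standard φ Δ) where
  l := φ.σ
  r := φ.τ
  l_plus j hj := .inl ⟨j, rfl, hj, rfl⟩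
  l_minus j hj := .inl ⟨j, rfl, hj, rfl⟩
  r_plus j hj := .inr ⟨j, rfl, hj, rfl⟩
  r_minus j hj := .inr ⟨j, rfl, hj, rfl⟩
  index_l _ := rfl
  index_r _ := rfl
  app D s _ := φ.app fun v => D.obj ⟨v, s v⟩
  app_const D c hc h₁ h₂ := by
    exact (comp_congr_outer _ (map_diagHom_refl D X.functor h₁)
      (map_diagHom_refl D Y.functor h₂)).trans
        ((Category.id_comp _).trans (Category.comp_id _)) |>.symm
  hexagon D s s' hs hs' t ht hts hd := by
    have hle : ∀ v, (⟨v, s' v⟩ : Stage V) ≤ ⟨v, s v⟩ := by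
      intro v
      refine ⟨rfl, fun hv => ?_⟩
      by_cases hvt : v = t
      · rw [hvt]; exact ht
      · exact (hts v hvt).trans hv
    -- Transitions of a standard graph are the variables themselves, so firing `t` moves only the
    -- variable `t` and ordinary dinaturality applies.
    refine (φ.hexagon_iff_diagHexagon D hle).1
      ((φ.dinaturalAt_iff t).1 (h.disc_spec t hd).2 _ _ _ fun v hv => ?_)
    have hvs : (⟨v, s' v⟩ : Stage V) = ⟨v, s v⟩ := congrArg (Stage.mk v) (hts v hv)
    exact ⟨congrArg D.obj hvs, map_homOfLE_eq_eqToHom D (hle v) hvs⟩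

end Tuple

end

end GenFun

/-! ### Refinements of composites and dinaturality -/

namespace GenFun

section

variable {B : Type u₁} [Category.{v₁} B] {C : Type u₂} [Category.{v₂} C] {K : Type} [Preorder K]

/-! ### Composites of hexagons -/

theorem diagHom_restrict {K' : Type} [Preorder K'] (U : K' ⥤ K) (D : K ⥤ B) {α : List Variance}
    {a b a' b' : Fin α.length → K'} (h : ArgsLE (α := α) a b a' b')
    (h' : ArgsLE (α := α) (fun j => U.obj (a j)) (fun j => U.obj (b j)) (fun j => U.obj (a' j))
      (fun j => U.obj (b' j))) : diagHom (U ⋙ D) h = diagHom D h' := by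
  funext j
  change Signed.mixHom (U ⋙ D) _ (h j) = Signed.mixHom D _ (h' j)
  generalize h j = hj
  generalize h' j = hj'
  revert hj hj'
  cases α.get j <;> intro hj hj' <;> rfl

theorem DiagHexagon.of_restrict {K' : Type} [Preorder K'] (U : K' ⥤ K) (D : K ⥤ B)
    {α β : List Variance} {F : MixedPow B α ⥤ C} {G : MixedPow B β ⥤ C}
    {x y : Fin α.length → K'} {x' y' : Fin β.length → K'}
    {ex : F.obj (diagArgs (U ⋙ D) x x) ⟶ G.obj (diagArgs (U ⋙ D) x' x')}
    {ey : F.obj (diagArgs (U ⋙ D) y y) ⟶ G.obj (diagArgs (U ⋙ D) y' y')}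
    (hxy : ∀ j, x j ≤ y j) (hxy' : ∀ j, x' j ≤ y' j) (H : DiagHexagon (U ⋙ D) F G ex ey) :
    DiagHexagon D F G (x := fun j => U.obj (x j)) (y := fun j => U.obj (y j))
      (x' := fun j => U.obj (x' j)) (y' := fun j => U.obj (y' j)) ex ey := by
  intro h₁ h₂ h₃ h₄
  have k₁ : ArgsLE (α := α) y x x x := .of_le hxy fun _ => le_rfl
  have k₂ : ArgsLE (α := β) x' x' x' y' := .of_le (fun _ => le_rfl) hxy'
  have k₃ : ArgsLE (α := α) y x y y := .of_le (fun _ => le_rfl) hxy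
  have k₄ : ArgsLE (α := β) y' y' x' y' := .of_le hxy' fun _ => le_rfl
  exact (comp_congr_outer ex (congrArg F.map (diagHom_restrict U D k₁ h₁))
    (congrArg G.map (diagHom_restrict U D k₂ h₂))).symm.trans
      ((H k₁ k₂ k₃ k₄).trans (comp_congr_outer ey (congrArg F.map (diagHom_restrict U D k₃ h₃))
        (congrArg G.map (diagHom_restrict U D k₄ h₄))))

section

variable {D : K ⥤ B} {α β γ : List Variance} {F : MixedPow B α ⥤ C} {G : MixedPow B β ⥤ C}
  {H : MixedPow B γ ⥤ C}

/-- Only the first factor moves. Both maps into `G` at `(z, z)` factor through `G` at `(x', y')`,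
where the given hexagon ends, by the map that is `mx` on contravariant and `my` on covariant
arguments. -/
theorem DiagHexagon.comp_left {x y : Fin α.length → K} {x' y' z : Fin β.length → K}
    {w : Fin γ.length → K} {ex : F.obj (diagArgs D x x) ⟶ G.obj (diagArgs D x' x')}
    {ey : F.obj (diagArgs D y y) ⟶ G.obj (diagArgs D y' y')} (hxy' : ∀ j, x' j ≤ y' j)
    (hex : DiagHexagon D F G ex ey) (mx : ArgsLE (α := β) x' x' z z)
    (my : ArgsLE (α := β) y' y' z z) (e : G.obj (diagArgs D z z) ⟶ H.obj (diagArgs D w w)) :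
    DiagHexagon D F H (ex ≫ G.map (diagHom D mx) ≫ e) (ey ≫ G.map (diagHom D my) ≫ e) := by
  intro h₁ h₂ h₃ h₄
  have E := congrArg (fun k => k ≫ G.map (diagHom D (mx.combine my)) ≫ e)
    (hex h₁ (.of_le (fun _ => le_rfl) hxy') h₃ (.of_le hxy' fun _ => le_rfl))
  simp only [Category.assoc, map_diagHom_comp_assoc] at E
  simpa only [Category.assoc, map_diagHom_refl, Category.comp_id] using E

/-- Dually, both maps out of `G` at `(z, z)` factor through `G` at `(y, x)`, where the given hexagon
starts. -/
theorem DiagHexagon.comp_right {w : Fin α.length → K} {z x y : Fin β.length → K}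
    {x' y' : Fin γ.length → K} {ex : G.obj (diagArgs D x x) ⟶ H.obj (diagArgs D x' x')}
    {ey : G.obj (diagArgs D y y) ⟶ H.obj (diagArgs D y' y')} (hxy : ∀ j, x j ≤ y j)
    (hex : DiagHexagon D G H ex ey) (mx : ArgsLE (α := β) z z x x)
    (my : ArgsLE (α := β) z z y y) (e : F.obj (diagArgs D w w) ⟶ G.obj (diagArgs D z z)) :
    DiagHexagon D F H (e ≫ G.map (diagHom D mx) ≫ ex) (e ≫ G.map (diagHom D my) ≫ ey) := by
  intro h₁ h₂ h₃ h₄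
  have E := congrArg (fun k => e ≫ G.map (diagHom D (my.combine mx)) ≫ k)
    (hex (.of_le hxy fun _ => le_rfl) h₂ (.of_le (fun _ => le_rfl) hxy) h₄)
  simp only [map_diagHom_comp_assoc] at E
  simpa only [Category.assoc, map_diagHom_refl, Category.id_comp] using E

theorem sandwich_eq {a₁ a₂ a₃ a₄ b₁ b₂ b₃ b₄ : C} {x : a₁ ⟶ a₂} {f : a₂ ⟶ a₃} {f' : a₃ ⟶ a₄}
    {φ : a₄ ⟶ b₄} {g' : b₄ ⟶ b₃} {g : b₃ ⟶ b₂} {z : b₂ ⟶ b₁} {k : a₁ ⟶ a₄} {k' : b₄ ⟶ b₁}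
    (hk : x ≫ f ≫ f' = k) (hk' : g' ≫ g ≫ z = k') :
    x ≫ (f ≫ (f' ≫ φ ≫ g') ≫ g) ≫ z = k ≫ φ ≫ k' := by
  subst hk hk'
  simp only [Category.assoc]

theorem comp_of_factors {a a' b b' c c' d d' : C} {e : a ⟶ b} {m : b ⟶ c} {e' : c ⟶ d}
    {f : a ⟶ a'} {φ : a' ⟶ b'} {g : b' ⟶ b} {g' : c ⟶ c'} {ψ : c' ⟶ d'} {h : d' ⟶ d}
    (he : e = f ≫ φ ≫ g) (he' : e' = g' ≫ ψ ≫ h) (q : b' ⟶ c') (hq : q = g ≫ m ≫ g')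
    {f' : a ⟶ a'} {h' : d' ⟶ d} (hf : f = f') (hh : h = h') :
    e ≫ m ≫ e' = f' ≫ (φ ≫ q ≫ ψ) ≫ h' := by
  subst he he' hq hf hh
  simp only [Category.assoc]

end

namespace Tuple

variable {X Y Z : Obj B C}

/-! ### Refinements of composites -/

theorem Closed.comp_inl {Φ : Tuple X Y} {Ψ : Tuple Y Z} {s : (Φ.comp Ψ).graph.net.T → Bool}
    (h : (Φ.comp Ψ).Closed s) : Φ.Closed fun t => s (Sum.inl t) :=
  fun p t t' hp hp' => h (Pushout.inl p) (Sum.inl t) (Sum.inl t') ⟨p, hp, rfl⟩ ⟨p, hp', rfl⟩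

theorem Closed.comp_inr {Φ : Tuple X Y} {Ψ : Tuple Y Z} {s : (Φ.comp Ψ).graph.net.T → Bool}
    (h : (Φ.comp Ψ).Closed s) : Ψ.Closed fun t => s (Sum.inr t) :=
  fun p t t' hp hp' => h (Pushout.inr p) (Sum.inr t) (Sum.inr t') ⟨p, hp, rfl⟩ ⟨p, hp', rfl⟩

/-- This is where closedness is needed. A token crosses an interface place forwards if its sign is
`+` and backwards if it is `-`; in either case the producer has fired if the consumer has, which is
the inequality demanded by the variance. -/
theorem Refinement.argsLE_middle {Φ : Tuple X Y} {Ψ : Tuple Y Z} (R : Refinement Φ)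
    (R' : Refinement Ψ) {s : (Φ.comp Ψ).graph.net.T → Bool} (hs : (Φ.comp Ψ).Closed s) :
    ArgsLE (α := Y.arity)
      (fun j => (Φ.comp Ψ).stage s (Sum.inl (R.r j))) (fun j => (Φ.comp Ψ).stage s (Sum.inl (R.r j)))
      (fun j => (Φ.comp Ψ).stage s (Sum.inr (R'.l j)))
      (fun j => (Φ.comp Ψ).stage s (Sum.inr (R'.l j))) := by
  have hv : ∀ j, ((Φ.comp Ψ).stage s (Sum.inl (R.r j))).var =
      ((Φ.comp Ψ).stage s (Sum.inr (R'.l j))).var := fun j =>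
    (congrArg Pushout.inl (R.index_r j)).trans
      ((Pushout.condition j).trans (congrArg Pushout.inr (R'.index_l j).symm))
  refine .intro (fun j hj => ⟨(hv j).symm, ?_⟩) (fun j hj => ⟨hv j, ?_⟩)
  · exact hs (Pushout.inr (Ψ.graph.left j)) _ _ ⟨_, R'.l_minus j hj, rfl⟩
      ⟨_, R.r_minus j hj, Pushout.condition j⟩
  · exact hs (Pushout.inr (Ψ.graph.left j)) _ _ ⟨_, R.r_plus j hj, Pushout.condition j⟩
      ⟨_, R'.l_plus j hj, rfl⟩

/-- The family of morphisms of a composite. -/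
noncomputable def Refinement.compApp {Φ : Tuple X Y} {Ψ : Tuple Y Z} (R : Refinement Φ) (R' : Refinement Ψ)
    (D : Stage (Φ.comp Ψ).V ⥤ B) (s : (Φ.comp Ψ).graph.net.T → Bool) (hs : (Φ.comp Ψ).Closed s) :
    X.functor.obj (diagArgs D (fun j => (Φ.comp Ψ).stage s (Sum.inl (R.l j)))
        (fun j => (Φ.comp Ψ).stage s (Sum.inl (R.l j)))) ⟶
      Z.functor.obj (diagArgs D (fun j => (Φ.comp Ψ).stage s (Sum.inr (R'.r j)))
        (fun j => (Φ.comp Ψ).stage s (Sum.inr (R'.r j)))) :=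
  R.app (Stage.mapFunctor Pushout.inl ⋙ D) _ hs.comp_inl ≫
    Y.functor.map (diagHom D (R.argsLE_middle R' hs)) ≫
    R'.app (Stage.mapFunctor Pushout.inr ⋙ D) _ hs.comp_inr

theorem Refinement.compApp_const {Φ : Tuple X Y} {Ψ : Tuple Y Z} (R : Refinement Φ)
    (R' : Refinement Ψ) (D : Stage (Φ.comp Ψ).V ⥤ B) (c : (Φ.comp Ψ).V → Bool)
    (hc : (Φ.comp Ψ).Closed fun t => c ((Φ.comp Ψ).graph.index (Sum.inr t)))
    (h₁ : ArgsLE (α := X.arity)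
      (fun j => (Φ.comp Ψ).stage (fun t => c ((Φ.comp Ψ).graph.index (Sum.inr t)))
        (Sum.inl (R.l j)))
      (fun j => (Φ.comp Ψ).stage (fun t => c ((Φ.comp Ψ).graph.index (Sum.inr t)))
        (Sum.inl (R.l j)))
      (fun j => ⟨(Φ.comp Ψ).trans.σ j, c ((Φ.comp Ψ).trans.σ j)⟩)
      (fun j => ⟨(Φ.comp Ψ).trans.σ j, c ((Φ.comp Ψ).trans.σ j)⟩))
    (h₂ : ArgsLE (α := Z.arity)
      (fun j => ⟨(Φ.comp Ψ).trans.τ j, c ((Φ.comp Ψ).trans.τ j)⟩)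
      (fun j => ⟨(Φ.comp Ψ).trans.τ j, c ((Φ.comp Ψ).trans.τ j)⟩)
      (fun j => (Φ.comp Ψ).stage (fun t => c ((Φ.comp Ψ).graph.index (Sum.inr t)))
        (Sum.inr (R'.r j)))
      (fun j => (Φ.comp Ψ).stage (fun t => c ((Φ.comp Ψ).graph.index (Sum.inr t)))
        (Sum.inr (R'.r j)))) :
    R.compApp R' D _ hc = X.functor.map (diagHom D h₁) ≫
      (Φ.comp Ψ).trans.app (fun v => D.obj ⟨v, c v⟩) ≫ Z.functor.map (diagHom D h₂) := by
  let c₁ : Φ.V → Bool := fun v => c (Pushout.inl v)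
  let c₂ : Ψ.V → Bool := fun v => c (Pushout.inr v)
  have eql : ∀ j, Φ.stage (fun t => c₁ (Φ.graph.index (Sum.inr t))) (R.l j) =
      ⟨Φ.trans.σ j, c₁ (Φ.trans.σ j)⟩ := fun j => by rw [← R.index_l]; rfl
  have eqr : ∀ j, Φ.stage (fun t => c₁ (Φ.graph.index (Sum.inr t))) (R.r j) =
      ⟨Φ.trans.τ j, c₁ (Φ.trans.τ j)⟩ := fun j => by rw [← R.index_r]; rfl
  have eql' : ∀ j, Ψ.stage (fun t => c₂ (Ψ.graph.index (Sum.inr t))) (R'.l j) =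
      ⟨Ψ.trans.σ j, c₂ (Ψ.trans.σ j)⟩ := fun j => by rw [← R'.index_l]; rfl
  have eqr' : ∀ j, Ψ.stage (fun t => c₂ (Ψ.graph.index (Sum.inr t))) (R'.r j) =
      ⟨Ψ.trans.τ j, c₂ (Ψ.trans.τ j)⟩ := fun j => by rw [← R'.index_r]; rfl
  have k₁ := ArgsLE.of_le (α := X.arity) (fun j => (eql j).ge) (fun j => (eql j).le)
  have k₂ := ArgsLE.of_le (α := Y.arity) (fun j => (eqr j).le) (fun j => (eqr j).ge)
  have k₁' := ArgsLE.of_le (α := Y.arity) (fun j => (eql' j).ge) (fun j => (eql' j).le)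
  have k₂' := ArgsLE.of_le (α := Z.arity) (fun j => (eqr' j).le) (fun j => (eqr' j).ge)
  have E := R.app_const (Stage.mapFunctor Pushout.inl ⋙ D) c₁ hc.comp_inl k₁ k₂
  have E' := R'.app_const (Stage.mapFunctor Pushout.inr ⋙ D) c₂ hc.comp_inr k₁' k₂'
  have n₂ := ArgsLE.of_le (α := Y.arity)
    (fun j => (Stage.mapFunctor (Pushout.inl (f := Φ.trans.τ) (g := Ψ.trans.σ))).monotone (eqr j).le)
    (fun j => (Stage.mapFunctor (Pushout.inl (f := Φ.trans.τ) (g := Ψ.trans.σ))).monotone (eqr j).ge)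
  have n₁' := ArgsLE.of_le (α := Y.arity)
    (fun j => (Stage.mapFunctor (Pushout.inr (f := Φ.trans.τ) (g := Ψ.trans.σ))).monotone
      (eql' j).ge)
    (fun j => (Stage.mapFunctor (Pushout.inr (f := Φ.trans.τ) (g := Ψ.trans.σ))).monotone
      (eql' j).le)
  refine comp_of_factors E E' _ ?_
    (congrArg X.functor.map (diagHom_restrict (Stage.mapFunctor Pushout.inl) D k₁ h₁))
    (congrArg Z.functor.map (diagHom_restrict (Stage.mapFunctor Pushout.inr) D k₂' h₂))
  refine Eq.trans ?_ (comp_congr_outer _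
    (congrArg Y.functor.map (diagHom_restrict (Stage.mapFunctor Pushout.inl) D k₂ n₂))
    (congrArg Y.functor.map (diagHom_restrict (Stage.mapFunctor Pushout.inr) D k₁' n₁'))).symm
  have hm : (fun j : Fin Y.arity.length => (⟨Pushout.inl (Φ.trans.τ j),
      c (Pushout.inl (Φ.trans.τ j))⟩ : Stage (Φ.comp Ψ).V)) =
      fun j => ⟨Pushout.inr (Ψ.trans.σ j), c (Pushout.inr (Ψ.trans.σ j))⟩ :=
    funext fun j => congrArg (fun v => (⟨v, c v⟩ : Stage (Φ.comp Ψ).V)) (Pushout.condition j)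
  -- The `eqToHom` in the definition of the composite is itself a comparison map between equal
  -- stages, so it agrees with the detour through the stages of the transitions.
  refine (eqToHom_eq_map_diagHom D Y.functor hm hm _
    ((n₂.trans (R.argsLE_middle R' hc)).trans n₁')).trans ?_
  exact ((map_diagHom_comp_assoc D Y.functor n₂ (R.argsLE_middle R' hc) _).trans
    (map_diagHom_comp D Y.functor _ n₁')).symm

theorem Refinement.compApp_hexagon {Φ : Tuple X Y} {Ψ : Tuple Y Z} (R : Refinement Φ)
    (R' : Refinement Ψ) (D : Stage (Φ.comp Ψ).V ⥤ B) (s s' : (Φ.comp Ψ).graph.net.T → Bool)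
    (hs : (Φ.comp Ψ).Closed s) (hs' : (Φ.comp Ψ).Closed s') (t : (Φ.comp Ψ).graph.net.T)
    (ht : s' t = true) (hts : ∀ t', t' ≠ t → s' t' = s t')
    (hd : (Φ.comp Ψ).disc ((Φ.comp Ψ).graph.index (Sum.inr t)) = true) :
    DiagHexagon D X.functor Z.functor (R.compApp R' D s' hs') (R.compApp R' D s hs) := by
  rw [comp_disc_eq_true] at hd
  have hle : ∀ t, s t = true → s' t = true := by
    intro t' h
    by_cases htt : t' = t
    · rw [htt]; exact ht
    · rw [hts _ htt]; exact h
  rcases t with t | t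
  -- Splitting the two states makes their second halves literally equal, so the second factor is the
  -- same morphism before and after firing.
  · obtain ⟨s₁, s₂, rfl⟩ : ∃ (s₁ : Φ.graph.net.T → Bool) (s₂ : Ψ.graph.net.T → Bool),
        s = Sum.elim s₁ s₂ := ⟨_, _, (Sum.elim_comp_inl_inr s).symm⟩
    obtain ⟨s₁', rfl⟩ : ∃ s₁' : Φ.graph.net.T → Bool, s' = Sum.elim s₁' s₂ := by
      refine ⟨fun t => s' (Sum.inl t), funext ?_⟩
      rintro (t' | t')
      · rfl
      · exact hts _ (by rintro ⟨⟩)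
    have H := R.hexagon (Stage.mapFunctor Pushout.inl ⋙ D) s₁ s₁' hs.comp_inl hs'.comp_inl t ht
      (fun t' ht' => hts (Sum.inl t') (fun h => ht' (Sum.inl_injective h))) (hd.2.1 _ rfl)
    have hl : ∀ t, s₁ t = true → s₁' t = true := fun t => hle (Sum.inl t)
    exact (DiagHexagon.of_restrict (Stage.mapFunctor Pushout.inl) D
      (fun j => Φ.stage_le hl _) (fun j => Φ.stage_le hl _) H).comp_left
        (fun j => (Φ.comp Ψ).stage_le hle (Sum.inl (R.r j))) (R.argsLE_middle R' hs')
        (R.argsLE_middle R' hs) (R'.app (Stage.mapFunctor Pushout.inr ⋙ D) s₂ hs.comp_inr)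
  · obtain ⟨s₁, s₂, rfl⟩ : ∃ (s₁ : Φ.graph.net.T → Bool) (s₂ : Ψ.graph.net.T → Bool),
        s = Sum.elim s₁ s₂ := ⟨_, _, (Sum.elim_comp_inl_inr s).symm⟩
    obtain ⟨s₂', rfl⟩ : ∃ s₂' : Ψ.graph.net.T → Bool, s' = Sum.elim s₁ s₂' := by
      refine ⟨fun t => s' (Sum.inr t), funext ?_⟩
      rintro (t' | t')
      · exact hts _ (by rintro ⟨⟩)
      · rfl
    have H := R'.hexagon (Stage.mapFunctor Pushout.inr ⋙ D) s₂ s₂' hs.comp_inr hs'.comp_inr t ht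
      (fun t' ht' => hts (Sum.inr t') (fun h => ht' (Sum.inr_injective h))) (hd.2.2 _ rfl)
    have hl : ∀ t, s₂ t = true → s₂' t = true := fun t => hle (Sum.inr t)
    exact (DiagHexagon.of_restrict (Stage.mapFunctor Pushout.inr) D
      (fun j => Ψ.stage_le hl _) (fun j => Ψ.stage_le hl _) H).comp_right
        (fun j => (Φ.comp Ψ).stage_le hle (Sum.inr (R'.l j))) (R.argsLE_middle R' hs')
        (R.argsLE_middle R' hs) (R.app (Stage.mapFunctor Pushout.inl ⋙ D) s₁ hs.comp_inl)

/-- The refinement of a composite. -/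
noncomputable def Refinement.comp {Φ : Tuple X Y} {Ψ : Tuple Y Z} (R : Refinement Φ) (R' : Refinement Ψ) :
    Refinement (Φ.comp Ψ) where
  l j := Sum.inl (R.l j)
  r j := Sum.inr (R'.r j)
  l_plus j hj := ⟨_, R.l_plus j hj, rfl⟩
  l_minus j hj := ⟨_, R.l_minus j hj, rfl⟩
  r_plus j hj := ⟨_, R'.r_plus j hj, rfl⟩
  r_minus j hj := ⟨_, R'.r_minus j hj, rfl⟩
  index_l j := congrArg Pushout.inl (R.index_l j)
  index_r j := congrArg Pushout.inr (R'.index_r j)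
  app := R.compApp R'
  app_const := R.compApp_const R'
  hexagon := R.compApp_hexagon R'

/-! ### Dinaturality from a refinement -/

/-- Induction on the number of transitions still to be fired: fire a causally minimal one and paste
its hexagon with the one for the rest. -/
theorem Refinement.diagHexagon_of_acyclic {Φ : Tuple X Y} (R : Refinement Φ)
    (D : Stage Φ.V ⥤ B) {i : Φ.V} (hi : Φ.disc i = true) (hac : Φ.graph.AcyclicAt i)
    (n : ℕ) (s s' : Φ.graph.net.T → Bool) (hs : Φ.Closed s) (hs' : Φ.Closed s')
    (hle : ∀ t, s t = true → s' t = true)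
    (hsi : ∀ t, s t = false → s' t = true → Φ.graph.index (Sum.inr t) = i)
    (hn : {t | s t = false ∧ s' t = true}.ncard = n) :
    DiagHexagon D X.functor Y.functor (R.app D s' hs') (R.app D s hs) := by
  classical
  have := Φ.graph.net.finite_T
  induction n generalizing s with
  | zero =>
    rw [Set.ncard_eq_zero (Set.toFinite _)] at hn
    obtain rfl : s = s' := by
      funext t
      cases h : s t
      · by_contra h'
        exact (Set.ext_iff.1 hn t).1 ⟨h, Bool.eq_true_of_not_eq_false (Ne.symm h')⟩
      · exact (hle t h).symm
    exact .refl D _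
  | succ n ih =>
    let S := {t | s t = false ∧ s' t = true}
    -- Reachability is irreflexive on `S` because component `i` is acyclic. Since `S` is finite, a
    -- minimal element exists.
    let r : S → S → Prop := fun a b => Relation.TransGen Φ.graph.net.Arc (Sum.inr a.1) (Sum.inr b.1)
    have hne : S.Nonempty := Set.nonempty_of_ncard_ne_zero (by rw [hn]; exact Nat.succ_ne_zero n)
    have : IsTrans S r := ⟨fun _ _ _ h h' => Relation.TransGen.trans h h'⟩
    have : Std.Irrefl r := ⟨fun a h => hac _ (hsi a.1 a.2.1 a.2.2) h⟩
    obtain ⟨⟨t, ht, ht'⟩, -, hmin⟩ := (Finite.wellFounded_of_trans_of_irrefl r).has_min Set.univ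
      ⟨⟨_, hne.some_mem⟩, trivial⟩
    have hs'' : Φ.Closed (Function.update s t true) := by
      intro p t₁ t₂ h₁ h₂ h
      by_cases h1 : t₁ = t
      · rw [h1, Function.update_self]
      rw [Function.update_of_ne h1]
      by_cases h2 : t₂ = t
      · subst h2
        by_contra hf
        -- A cause of `t` not yet fired would lie in `S`, since `s'` is closed, and would precede
        -- `t`.
        exact hmin ⟨t₁, Bool.eq_false_iff.2 hf, hs' p t₁ t₂ h₁ h₂ ht'⟩ trivial
          (.tail (.single (.out h₁)) (.inp h₂))
      · rw [Function.update_of_ne h2] at h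
        exact hs p t₁ t₂ h₁ h₂ h
    have hle₁ : ∀ t', s t' = true → Function.update s t true t' = true := by
      intro t' h
      by_cases h1 : t' = t
      · rw [h1, Function.update_self]
      · rwa [Function.update_of_ne h1]
    have hle₂ : ∀ t', Function.update s t true t' = true → s' t' = true := by
      intro t' h
      by_cases h1 : t' = t
      · rwa [h1]
      · rw [Function.update_of_ne h1] at h
        exact hle _ h
    have hset : {t' | Function.update s t true t' = false ∧ s' t' = true} = S \ {t} := by
      ext t'
      by_cases h1 : t' = t
      · simp [h1]
      · simp [S, h1]
    have H := R.hexagon D s _ hs hs'' t (Function.update_self ..)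
      (fun t' h => Function.update_of_ne h ..) (by rw [hsi t ht ht']; exact hi)
    refine DiagHexagon.trans (fun j => Φ.stage_le hle₂ _) (fun j => Φ.stage_le hle₁ _)
      (fun j => Φ.stage_le hle₂ _) (fun j => Φ.stage_le hle₁ _)
      (ih _ hs'' hle₂ (fun t' h h' => hsi t' ?_ h') ?_) H
    · by_contra h''
      rw [hle₁ t' (Bool.eq_true_of_not_eq_false h'')] at h
      exact Bool.noConfusion h
    · rw [hset, Set.ncard_sdiff_singleton_of_mem (show t ∈ S from ⟨ht, ht'⟩)]
      exact Nat.sub_eq_of_eq_add hn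

theorem _root_.GenFun.Transformation.Hexagon.congr_target {α β : List Variance} {V : Type}
    {F : MixedPow B α ⥤ C} {G : MixedPow B β ⥤ C} {φ : Transformation V F G} {P Q Q' : V → B}
    {h : ∀ v, P v ⟶ Q v} {h' : ∀ v, P v ⟶ Q' v} (H : φ.Hexagon h) (e : Q = Q')
    (hh : ∀ v, h v ≫ eqToHom (congrFun e v) = h' v) : φ.Hexagon h' := by
  subst e
  obtain rfl : h = h' := funext fun v => (Category.comp_id _).symm.trans (hh v)
  exact H

/-- The two extreme states are constant on components, so there the refined family is the
transformation itself and the pasted hexagon is the required one. -/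
theorem Refinement.dinaturalAt {Φ : Tuple X Y} (R : Refinement Φ) (hΦ : Φ.graph.IsGraph)
    {i : Φ.V} (hi : Φ.disc i = true) (hac : Φ.graph.AcyclicAt i) : Φ.trans.DinaturalAt i := by
  classical
  intro A P Q f
  let D : Stage Φ.V ⥤ B := Stage.ofArrows (substHom A i f)
  have closed : ∀ c : Φ.V → Bool, Φ.Closed fun t => c (Φ.graph.index (Sum.inr t)) := by
    intro c p t t' h h' hc
    change c _ = true
    rw [(hΦ.index_eq_iff (Sum.inr t) (Sum.inr t')).2
      (.trans _ _ _ (.rel _ _ (.out h)) (.rel _ _ (.inp h')))]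
    exact hc
  -- Variables other than `i` count as fired throughout, so they stay at the source of the family,
  -- where the substituted arrow is an identity up to equality of objects.
  let c : Φ.V → Bool := fun v => decide (v ≠ i)
  let c₁ : Φ.V → Bool := fun _ => true
  have hle : ∀ v, (⟨v, c₁ v⟩ : Stage Φ.V) ≤ ⟨v, c v⟩ := fun v => ⟨rfl, fun _ => rfl⟩
  have H := R.diagHexagon_of_acyclic D hi hac _ _ _ (closed c) (closed c₁) (fun _ _ => rfl)
    (fun t h _ => by simpa [c] using h) rfl
  have eql : ∀ (c : Φ.V → Bool) j, Φ.stage (fun t => c (Φ.graph.index (Sum.inr t))) (R.l j) =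
      ⟨Φ.trans.σ j, c (Φ.trans.σ j)⟩ := fun c j => by rw [← R.index_l]; rfl
  have eqr : ∀ (c : Φ.V → Bool) j, Φ.stage (fun t => c (Φ.graph.index (Sum.inr t))) (R.r j) =
      ⟨Φ.trans.τ j, c (Φ.trans.τ j)⟩ := fun c j => by rw [← R.index_r]; rfl
  have happ := fun c => R.app_const D c (closed c)
    (.of_le (fun j => (eql c j).ge) (fun j => (eql c j).le))
    (.of_le (fun j => (eqr c j).le) (fun j => (eqr c j).ge))
  have H' : Φ.trans.Hexagon (fun v => D.map (homOfLE (hle v))) := by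
    rw [Transformation.hexagon_iff_diagHexagon]
    intro h₁ h₂ h₃ h₄
    have hlel : ∀ j, Φ.stage (fun t => c₁ (Φ.graph.index (Sum.inr t))) (R.l j) ≤
      Φ.stage (fun t => c (Φ.graph.index (Sum.inr t))) (R.l j) := fun j => ⟨rfl, fun _ => rfl⟩
    have hler : ∀ j, Φ.stage (fun t => c₁ (Φ.graph.index (Sum.inr t))) (R.r j) ≤
      Φ.stage (fun t => c (Φ.graph.index (Sum.inr t))) (R.r j) := fun j => ⟨rfl, fun _ => rfl⟩
    have E := H (.of_le hlel fun _ => le_rfl) (.of_le (fun _ => le_rfl) hler)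
      (.of_le (fun _ => le_rfl) hlel) (.of_le hler fun _ => le_rfl)
    rw [happ c, happ c₁] at E
    have z₁ := ArgsLE.of_le (α := X.arity) (fun j => (eql c j).le) (fun j => (eql c₁ j).ge)
    have z₂ := ArgsLE.of_le (α := Y.arity) (fun j => (eqr c₁ j).ge) (fun j => (eqr c j).le)
    have E' := congrArg (fun k => X.functor.map (diagHom D z₁) ≫ k ≫
      Y.functor.map (diagHom D z₂)) E
    refine (sandwich_eq ?_ ?_).symm.trans (E'.trans (sandwich_eq ?_ ?_)) <;>
      exact (map_diagHom_comp_assoc D _ _ _ _).trans (map_diagHom_comp D _ _ _)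
  have hcv : ∀ v, v ≠ i → c v = true := fun v hv => decide_eq_true hv
  have hci : c i = false := by simp [c]
  -- The fired ends agree definitionally with `subst A i P`. The other ends need a transport, since
  -- away from `i` the diagram gives `subst A i P v`.
  have key : ∀ v, ∃ e : D.obj ⟨v, c v⟩ = subst A i Q v,
      D.map (homOfLE (hle v)) ≫ eqToHom e = substHom A i f v := by
    intro v
    generalize hle v = hlev
    by_cases hv : v = i
    · subst hv
      revert hlev
      rw [hci]
      intro hlev
      exact ⟨rfl, by simp [D, Stage.ofArrows, c₁]⟩
    · revert hlev
      rw [hcv v hv]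
      intro hlev
      refine ⟨subst_of_ne A P Q hv, ?_⟩
      rw [substHom_of_ne A i f hv]
      simp [D, Stage.ofArrows, c₁]
  exact H'.congr_target (funext fun v => (key v).1) fun v => (key v).2

end Tuple

end

end GenFun

/-! ### Composites of atomic tuples, morphisms and the category -/

namespace GenFun

section

variable {B : Type u₁} [Category.{v₁} B] {C : Type u₂} [Category.{v₂} C]

namespace Tuple

variable {X Y Z : Obj B C}

/-! ### Composites of atomic tuples are valid -/

theorem IsAtomic.exists_refinement {Φ : Tuple X Y} (h : Φ.IsAtomic) :
    ∃ Φ' : Tuple X Y, Φ ≈ Φ' ∧ Nonempty (Refinement Φ') := by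
  obtain ⟨V, hV, φ, Δ, e⟩ := h.standard
  exact ⟨_, e, ⟨standardRefinement (e.elim fun e => e.isValid h.valid)⟩⟩

theorem IsAtomic.endsCompatible {Φ : Tuple X Y} (h : Φ.IsAtomic) : Φ.EndsCompatible := by
  obtain ⟨V, hV, φ, Δ, e⟩ := h.standard
  exact (standard_endsCompatible φ Δ).of_equiv (Setoid.symm e)

theorem IsCompositeOfAtomics.exists_refinement {Φ : Tuple X Y} (h : Φ.IsCompositeOfAtomics) :
    ∃ Φ' : Tuple X Y, Φ ≈ Φ' ∧ Nonempty (Refinement Φ') := by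
  induction h with
  | atomic h => exact h.exists_refinement
  | comp _ h' ih =>
    obtain ⟨Φ', e, ⟨R⟩⟩ := ih
    obtain ⟨Ψ', e', ⟨R'⟩⟩ := h'.exists_refinement
    exact ⟨_, comp_congr e e', ⟨R.comp R'⟩⟩

theorem IsCompositeOfAtomics.isGraph {Φ : Tuple X Y} (h : Φ.IsCompositeOfAtomics) :
    Φ.graph.IsGraph ∧ Φ.EndsCompatible := by
  induction h with
  | atomic h => exact ⟨h.valid.isGraph, h.endsCompatible⟩
  | comp _ h' ih =>
    exact ⟨comp_isGraph ih.1 h'.valid.isGraph ih.2 h'.endsCompatible,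
      comp_endsCompatible h'.valid.isGraph.left_injective ih.2 h'.endsCompatible⟩

theorem IsCompositeOfAtomics.acyclicAt {Φ : Tuple X Y} (h : Φ.IsCompositeOfAtomics) {i : Φ.V}
    (hi : Φ.disc i = true) : Φ.graph.AcyclicAt i := by
  cases h with
  | atomic h => exact (h.valid.disc_spec i hi).1
  | comp _ _ => exact ((comp_disc_eq_true i).1 hi).1

/-- Atomic tuples are only equivalent to standard ones, so dinaturality is proved for an equivalent
tuple carrying a refinement and transported back. -/
theorem IsCompositeOfAtomics.isValid {Φ : Tuple X Y} (h : Φ.IsCompositeOfAtomics) :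
    Φ.IsValid := by
  obtain ⟨Φ', ⟨e⟩, ⟨R⟩⟩ := h.exists_refinement
  refine e.symm.isValid ⟨e.isGraph h.isGraph.1, fun i hi => ?_⟩
  obtain ⟨i, rfl⟩ := e.π.surjective i
  have hac := e.acyclicAt (h.acyclicAt ((e.disc_eq i).trans hi))
  exact ⟨hac, R.dinaturalAt (e.isGraph h.isGraph.1) hi hac⟩

/-- Composites of atomic tuples are bracketed to the left, so concatenating two of them requires
reassociation and holds only up to equivalence. -/
theorem IsCompositeOfAtomics.exists_comp {Φ : Tuple X Y} {Ψ : Tuple Y Z}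
    (hΦ : Φ.IsCompositeOfAtomics) (hΨ : Ψ.IsCompositeOfAtomics) :
    ∃ Ω : Tuple X Z, Ω.IsCompositeOfAtomics ∧ Φ.comp Ψ ≈ Ω := by
  induction hΨ with
  | atomic h => exact ⟨_, .comp hΦ h, Setoid.refl _⟩
  | comp _ h ih =>
    obtain ⟨Ω, hΩ, e⟩ := ih
    exact ⟨_, .comp hΩ h,
      Setoid.trans (Setoid.symm (comp_assoc _ _ _)) (comp_congr e (Setoid.refl _))⟩

/-! ### Morphisms -/

theorem id_isMorphism (X : Obj B C) : (Tuple.id X).IsMorphism where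
  valid := id_isValid X
  trivialOnlyIdentity _ := .mk (Setoid.refl _)
  composite _ h := (h (.mk (Setoid.refl _))).elim

theorem IsMorphism.exists_composite {Φ : Tuple X Y} (h : Φ.IsMorphism) (hid : ¬ Φ.IsIdentity) :
    ∃ Ψ : Tuple X Y, Ψ.IsCompositeOfAtomics ∧ Φ ≈ Ψ := by
  by_cases ha : Φ.IsAtomic
  · exact ⟨Φ, .atomic ha, Setoid.refl _⟩
  · exact h.composite ha hid

theorem IsMorphism.comp {Φ : Tuple X Y} {Ψ : Tuple Y Z} (hΦ : Φ.IsMorphism)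
    (hΨ : Ψ.IsMorphism) : (Φ.comp Ψ).IsMorphism := by
  by_cases iΦ : Φ.IsIdentity
  · cases iΦ with
    | mk e =>
      exact hΨ.of_equiv (Setoid.symm
        (Setoid.trans (comp_congr e (Setoid.refl _)) (id_comp hΨ.valid)))
  by_cases iΨ : Ψ.IsIdentity
  · cases iΨ with
    | mk e =>
      exact hΦ.of_equiv (Setoid.symm
        (Setoid.trans (comp_congr (Setoid.refl _) e) (comp_id hΦ.valid)))
  obtain ⟨Φ', cΦ, eΦ⟩ := hΦ.exists_composite iΦ
  obtain ⟨Ψ', cΨ, eΨ⟩ := hΨ.exists_composite iΨ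
  obtain ⟨Ω, cΩ, eΩ⟩ := cΦ.exists_comp cΨ
  have e : Φ.comp Ψ ≈ Ω := Setoid.trans (comp_congr eΦ eΨ) eΩ
  refine ⟨(Setoid.symm e).elim fun e => e.isValid cΩ.isValid, fun hT => ?_,
    fun _ _ => ⟨Ω, cΩ, e⟩⟩
  -- A composite net without transitions would leave `Φ` without any, making it an identity, a case
  -- already treated.
  exact (iΦ (hΦ.trivialOnlyIdentity ⟨fun t => hT.false (Sum.inl t)⟩)).elim

end Tuple

/-! ### The category -/

namespace Hom

theorem mk_eq_mk {X Y : Obj B C} {Φ Φ' : Tuple X Y} {h : Φ.IsMorphism} {h' : Φ'.IsMorphism}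
    (e : Φ ≈ Φ') : Hom.mk Φ h = Hom.mk Φ' h' :=
  Quotient.sound e

/-- Composition of equivalence classes. -/
noncomputable def comp {X Y Z : Obj B C} (f : Hom X Y) (g : Hom Y Z) : Hom X Z :=
  Quotient.liftOn₂ f g (fun Φ Ψ => Hom.mk (Φ.1.comp Ψ.1) (Φ.2.comp Ψ.2))
    fun _ _ _ _ h h' => mk_eq_mk (Tuple.comp_congr h h')

end Hom

/-- The generalised functor category. -/
@[reducible]
noncomputable def category (B : Type u₁) [Category.{v₁} B] (C : Type u₂) [Category.{v₂} C] :
    Category.{max 1 u₁ v₂} (Obj B C) where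
  Hom X Y := Hom X Y
  id X := Hom.mk (Tuple.id X) (Tuple.id_isMorphism X)
  comp f g := Hom.comp f g
  id_comp f := by
    induction f using Quotient.ind with
    | _ Φ => exact Hom.mk_eq_mk (Tuple.id_comp Φ.2.valid)
  comp_id f := by
    induction f using Quotient.ind with
    | _ Φ => exact Hom.mk_eq_mk (Tuple.comp_id Φ.2.valid)
  assoc f g h := by
    induction f using Quotient.ind with
    | _ Φ =>
    induction g using Quotient.ind with
    | _ Ψ =>
    induction h using Quotient.ind with
    | _ Ω => exact Hom.mk_eq_mk (Tuple.comp_assoc Φ.1 Ψ.1 Ω.1)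

end

end GenFun

theorem mainTheorem9 (B : Type u₁) [Category.{v₁} B]
    (C : Type u₂) [Category.{v₂} C] :
    ∃ (hid : ∀ X : GenFun.Obj B C, (GenFun.Tuple.id X).IsMorphism)
      (hcomp : ∀ {X Y Z : GenFun.Obj B C} (Φ : GenFun.Tuple X Y) (Ψ : GenFun.Tuple Y Z),
        Φ.IsMorphism → Ψ.IsMorphism → (Φ.comp Ψ).IsMorphism)
      (cat : Category.{max 1 u₁ v₂} (GenFun.Obj B C))
      (e : ∀ X Y : GenFun.Obj B C, (X ⟶ Y) ≃ GenFun.Hom X Y),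
      (∀ X : GenFun.Obj B C, e X X (𝟙 X) = GenFun.Hom.mk (GenFun.Tuple.id X) (hid X)) ∧
      ∀ {X Y Z : GenFun.Obj B C} (Φ : GenFun.Tuple X Y) (Ψ : GenFun.Tuple Y Z)
        (hΦ : Φ.IsMorphism) (hΨ : Ψ.IsMorphism),
        e X Z ((e X Y).symm (GenFun.Hom.mk Φ hΦ) ≫ (e Y Z).symm (GenFun.Hom.mk Ψ hΨ)) =
          GenFun.Hom.mk (Φ.comp Ψ) (hcomp Φ Ψ hΦ hΨ) := by
  exact ⟨GenFun.Tuple.id_isMorphism, fun _ _ hΦ hΨ => hΦ.comp hΨ, GenFun.category B C,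
    fun _ _ => Equiv.refl _, fun _ => rfl, fun _ _ _ _ => rfl⟩
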